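/- Let $\mathscr W$ be a monoidal category acting on the right of a (strict) 2-category $\mathscr A$ by 2-functors $-\star V$ and 2-natural transformations $-\star p$; that is, $\star$ corresponds to a strong monoidal functor from $\mathscr W$ to the category of 2-functors $\mathscr A\to\mathscr A$ and 2-natural transformations, with coherent invertible constraints $X\star(V\otimes V')\cong (X\star V)\star V'$ and $X\star I\cong X$. Let $(B,\delta,\varepsilon)$ be a comonoid in $\mathscr W$; then $-\star B$ is a 2-comonad on $\mathscr A$, with comultiplication $d_X\colon X\star B\to X\star(B\otimes B)\cong (X\star B)\star B$ and counit $e_X\colon X\star B\to X\star I\cong X$. Let $\gamma\colon A\to A\star B$ be any 1-cell of $\mathscr A$. A *normal lax $(-\star B)$-coalgebra structure* on $\gamma$ exists only if $e_A\circ\gamma=1_A$, and is then a 2-cell $\tau\colon(\gamma\star B)\circ\gamma\Rightarrow d_A\circ\gamma$ such that $e_{A\star B}\circ\tau$ and $(e_A\star B)\circ\tau$ are the identity 2-cell of $\gamma$ and such that the vertical composites $$(d_A\star B)\tau\cdot(\tau\star B)\gamma \quad\text{and}\quad d_{A\star B}\,\tau\cdot((\gamma\star B)\star B)\,\tau$$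 of 2-cells $((\gamma\star B)\star B)(\gamma\star B)\gamma\Rightarrow (d_A\star B)d_A\gamma=d_{A\star B}d_A\gamma$ are equal. Let $\mathbf\Delta_\top$ be the category of strictly positive finite ordinals and order- and last-element-preserving functions, and $\mathbf\Delta_{\bot,\top}$ its subcategory, with the same objects, of the functions that also preserve the first element. For ordinals $m,k$ put $m\oplus k=m+k-1$ (the last element of $m$ is identified with the first element of $k$), and for $\xi\colon m\to n$ in $\mathbf\Delta_\top$ let $\xi\oplus k\colon m\oplus k\to n\oplus k$ be $\xi$ on $m$ and the shift on the rest. Let $\bar A$ be given on objects by $\bar A(n)=A\star B^{\otimes(n-1)}$ and on the generating morphisms of $\mathbf\Delta_\top$ (where $\partial_r\colon n\to n+1$ omits $r$ and $\sigma_r\colon n+1\to n$ identifies $r$ and $r+1$) by $$\partial_0\mapsto\gamma\star B^{\otimes(n-1)},\qquad \partial_{r+1}\mapsto A\star(1_{B^{\otimes r}}\otimes\delta\otimes 1_{B^{\otimes(n-r-2)}})\ \ (0\le r\le n-2),\qquad \sigma_r\mapsto A\star(1_{B^{\otimes r}}\otimes\varepsilon\otimes 1_{B^{\otimes(n-r-1)}})\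 \ (0\le r\le n-1),$$ up to the constraint isomorphisms. By a *normal lax functor structure on $\bar A$* we mean an extension of this assignment to a normal lax functor $\bar A\colon\mathbf\Delta_\top\to\mathscr A$ with constraints $\bar A(\zeta)\circ\bar A(\xi)\Rightarrow\bar A(\zeta\circ\xi)$, which is compatible with the actions: under the canonical isomorphisms $\bar A(m)\star B^{\otimes(k-1)}\cong\bar A(m\oplus k)$, one has $\bar A(\xi\oplus k)=\bar A(\xi)\star B^{\otimes(k-1)}$, and the constraint at $(\zeta\oplus k,\xi\oplus k)$ is the constraint at $(\zeta,\xi)$ acted on by $B^{\otimes(k-1)}$. **Proposition.** Normal lax $(-\star B)$-coalgebra structures $\tau$ on $\gamma$ are in bijection with those normal lax functor structures on $\bar A$ whose constraints $\bar A(\zeta)\circ\bar A(\xi)\Rightarrow\bar A(\zeta\circ\xi)$ are identities unless neither $\xi$ nor $\zeta$ is in $\mathbf\Delta_{\bot,\top}$. Under this bijection the constraint $\bar A(\partial_0)\circ\bar A(\partial_0)\Rightarrow\bar A(\partial_0\circ\partial_0)$ at the ordinal $n$ is $\tau\star B^{\otimes(n-1)}$, up to the constraint isomorphisms of the action. In particular,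 each such $\bar A$ restricts along the inclusion $\mathbf\Delta_{\bot,\top}\rightarrowtail\mathbf\Delta_\top$ to a strict functor $\mathbf\Delta_{\bot,\top}\to\mathscr A$ (that is, since $\mathbf\Delta_{\bot,\top}\cong\mathbf\Delta^{\mathrm{op}}$, to an augmented simplicial object of $\mathscr A$). -/

import Mathlib

open CategoryTheory MonoidalCategory Bicategory
open scoped MonoidalRightAction ComonObj

universe w v u v₁ u₁

section TwoCells

variable {𝒜 : Type u} [Bicategory.{w, v} 𝒜]

/-- A 2-cell is an identity: its source and target are equal and it is the identity 2-cell
induced by that equality. -/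
def IsIdTwoCell {X Y : 𝒜} {f g : X ⟶ Y} (η : f ⟶ g) : Prop :=
  ∃ h : f = g, η = eqToHom h

/-- Two 2-cells, whose sources and targets are equal 1-cells (though possibly given by different
expressions), are equal. -/
def EqTwoCell {X Y : 𝒜} {f g f' g' : X ⟶ Y} (η : f ⟶ g) (θ : f' ⟶ g') : Prop :=
  ∃ (h : f = f') (k : g = g'), η = eqToHom h ≫ θ ≫ eqToHom k.symm

end TwoCells

/-- A right action of a monoidal category `W` on a (strict) 2-category `𝒜` by 2-functors and
2-natural transformations, i.e. a strong monoidal functor from `W` to the 2-functors `𝒜 ⥤ 𝒜`.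
The underlying action on the category of objects and 1-cells is Mathlib's `MonoidalRightAction`,
with `X ⊙ᵣ V` for `X ⋆ V`, `f ⊵ᵣ V` for `f ⋆ V` and `X ⊴ᵣ p` for `X ⋆ p`; the new datum
is the value `actionTwo η V` of the 2-functor `- ⋆ V` on a 2-cell `η`. -/
class TwoAction (W : Type u₁) [Category.{v₁} W] [MonoidalCategory W]
    (𝒜 : Type u) [Bicategory.{w, v} 𝒜] [Bicategory.Strict 𝒜] extends
    MonoidalRightAction W 𝒜 where
  actionTwo {X Y : 𝒜} {f g : X ⟶ Y} (η : f ⟶ g) (V : W) : (f ⊵ᵣ V) ⟶ (g ⊵ᵣ V)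
  /-- `- ⋆ V` preserves vertical identities and composites. -/
  actionTwo_id {X Y : 𝒜} (f : X ⟶ Y) (V : W) : actionTwo (𝟙 f) V = 𝟙 (f ⊵ᵣ V)
  actionTwo_comp {X Y : 𝒜} {f g h : X ⟶ Y} (η : f ⟶ g) (θ : g ⟶ h) (V : W) :
    actionTwo (η ≫ θ) V = actionTwo η V ≫ actionTwo θ V
  /-- `- ⋆ V` preserves whiskering. -/
  actionTwo_whiskerLeft {X Y Z : 𝒜} (f : X ⟶ Y) {g h : Y ⟶ Z} (η : g ⟶ h) (V : W) :
    EqTwoCell (actionTwo (f ◁ η) V) ((f ⊵ᵣ V) ◁ actionTwo η V)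
  actionTwo_whiskerRight {X Y Z : 𝒜} {f g : X ⟶ Y} (η : f ⟶ g) (h : Y ⟶ Z) (V : W) :
    EqTwoCell (actionTwo (η ▷ h) V) (actionTwo η V ▷ (h ⊵ᵣ V))
  /-- `- ⋆ p` is 2-natural. -/
  actionTwo_naturality {X Y : 𝒜} {f g : X ⟶ Y} (η : f ⟶ g) {V V' : W} (p : V ⟶ V') :
    EqTwoCell (actionTwo η V ▷ (Y ⊴ᵣ p)) ((X ⊴ᵣ p) ◁ actionTwo η V')
  /-- The associativity constraint of the action is 2-natural. -/
  actionTwo_assoc {X Y : 𝒜} {f g : X ⟶ Y} (η : f ⟶ g) (V V' : W) :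
    EqTwoCell (actionTwo η (V ⊗ V') ▷ (αᵣ Y V V').hom)
      ((αᵣ X V V').hom ◁ actionTwo (actionTwo η V) V')
  /-- The unit constraint of the action is 2-natural. -/
  actionTwo_unit {X Y : 𝒜} {f g : X ⟶ Y} (η : f ⟶ g) :
    EqTwoCell (actionTwo η (𝟙_ W) ▷ (ρᵣ[W] Y).hom) ((ρᵣ[W] X).hom ◁ η)

section Coalgebra

variable {W : Type u₁} [Category.{v₁} W] [MonoidalCategory W]
  {𝒜 : Type u} [Bicategory.{w, v} 𝒜] [Bicategory.Strict 𝒜] [TwoAction W 𝒜]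

/-- The comultiplication `X ⋆ B ⟶ (X ⋆ B) ⋆ B` of the 2-comonad `- ⋆ B`. -/
def comonadComul (B : W) [ComonObj B] (X : 𝒜) : X ⊙ᵣ B ⟶ (X ⊙ᵣ B) ⊙ᵣ B :=
  X ⊴ᵣ Δ[B] ≫ (αᵣ X B B).hom

/-- The counit `X ⋆ B ⟶ X` of the 2-comonad `- ⋆ B`. -/
def comonadCounit (B : W) [ComonObj B] (X : 𝒜) : X ⊙ᵣ B ⟶ X :=
  X ⊴ᵣ ε[B] ≫ (ρᵣ[W] X).hom

theorem comonadComul_naturality (B : W) [ComonObj B] {X Y : 𝒜} (f : X ⟶ Y) :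
    comonadComul B X ≫ (f ⊵ᵣ B) ⊵ᵣ B = f ⊵ᵣ B ≫ comonadComul B Y := by
  have h := MonoidalRightAction.action_exchange f Δ[B]
  have h' := MonoidalRightAction.actionHomLeft_tensor f B B
  simp only [comonadComul]
  rw [← reassoc_of% h, h']
  simp

/-- A normal lax coalgebra structure on `γ : A ⟶ A ⋆ B` for the 2-comonad `- ⋆ B`: the counit
constraint is an identity, and there is a coassociativity constraint
`τ : (γ ⋆ B) ∘ γ ⟶ comul ∘ γ` subject to the cocycle and unit conditions. -/
@[ext]
structure NormalLaxCoalgebra (B : W) [ComonObj B] {A : 𝒜} (γ : A ⟶ A ⊙ᵣ B) where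
  τ : γ ≫ γ ⊵ᵣ B ⟶ γ ≫ comonadComul B A
  counit : γ ≫ comonadCounit B A = 𝟙 A
  cocycle :
    EqTwoCell
      (γ ◁ TwoAction.actionTwo τ B ≫
        eqToHom (by simp : γ ≫ (γ ≫ comonadComul B A) ⊵ᵣ B =
          (γ ≫ γ ⊵ᵣ B) ≫ comonadComul B A ⊵ᵣ B) ≫
        τ ▷ (comonadComul B A ⊵ᵣ B))
      (τ ▷ ((γ ⊵ᵣ B) ⊵ᵣ B) ≫
        eqToHom (by simp [comonadComul_naturality] :
          (γ ≫ comonadComul B A) ≫ (γ ⊵ᵣ B) ⊵ᵣ B =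
          (γ ≫ γ ⊵ᵣ B) ≫ comonadComul B (A ⊙ᵣ B)) ≫
        τ ▷ comonadComul B (A ⊙ᵣ B))
  /-- Both counits send `τ` to the identity 2-cell of `γ`. -/
  normal_left : EqTwoCell (τ ▷ comonadCounit B (A ⊙ᵣ B)) (𝟙 γ)
  normal_right : EqTwoCell (τ ▷ (comonadCounit B A ⊵ᵣ B)) (𝟙 γ)

end Coalgebra

/-- The category of strictly positive finite ordinals and order- and last-element-preserving
functions; `⟨n⟩` is the ordinal `n + 1 = {0, …, n}`. -/
structure DeltaTop where
  len : ℕ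

namespace DeltaTop

instance : Category DeltaTop where
  Hom m n := {f : Fin (m.len + 1) →o Fin (n.len + 1) // f (Fin.last _) = Fin.last _}
  id _ := ⟨OrderHom.id, rfl⟩
  comp f g := ⟨g.1.comp f.1, by simp [f.2, g.2]⟩

/-- The morphisms of `DeltaTop` which also preserve the first element. -/
def PreservesBot {m n : DeltaTop} (f : m ⟶ n) : Prop := f.1 0 = 0

/-- `∂₀`: the injection omitting `0`. -/
def dZero (n : ℕ) : (⟨n⟩ : DeltaTop) ⟶ ⟨n + 1⟩ :=
  ⟨(Fin.succOrderEmb (n + 1)).toOrderHom, by simp⟩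

/-- `∂ᵣ₊₁`: the injection omitting `r + 1`, where `r + 1` is neither the first nor the last
element of the codomain. -/
def dSucc (n : ℕ) (r : Fin (n + 1)) : (⟨n + 1⟩ : DeltaTop) ⟶ ⟨n + 2⟩ :=
  ⟨(Fin.succAboveOrderEmb r.succ.castSucc).toOrderHom, by
    simp⟩

/-- `σᵣ`: the surjection identifying `r` and `r + 1`. -/
def s (n : ℕ) (r : Fin (n + 1)) : (⟨n + 1⟩ : DeltaTop) ⟶ ⟨n⟩ :=
  ⟨Fin.predAboveOrderHom r, by simp⟩

/-- The object `m ⊕ (k + 1)`, obtained from the ordinals `m` and `k + 1` by identifying the last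
element of `m` with the first element of `k + 1`. -/
def oplus (m : DeltaTop) (k : ℕ) : DeltaTop := ⟨k + m.len⟩

/-- The morphism `f ⊕ 1`, given by `f` on `m` and by a shift on the remaining elements. -/
def oplusMap {m n : DeltaTop} (f : m ⟶ n) (k : ℕ) : m.oplus k ⟶ n.oplus k :=
  ⟨{ toFun := fun i =>
      ⟨if h : i.1 < m.len + 1 then (f.1 ⟨i.1, h⟩).1 else n.len + (i.1 - m.len), by
        have hi : i.1 < k + m.len + 1 := i.2
        change _ < k + n.len + 1
        split_ifs with h
        · have := (f.1 ⟨i.1, h⟩).2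
          omega
        · omega⟩
     monotone' := by
      intro i j hij
      have hij' : i.1 ≤ j.1 := hij
      rw [Fin.mk_le_mk]
      split_ifs with h₁ h₂
      · exact f.1.monotone (show (⟨i.1, h₁⟩ : Fin _) ≤ ⟨j.1, h₂⟩ from hij')
      · have := (f.1 ⟨i.1, h₁⟩).2
        omega
      · omega
      · omega },
   by
    refine Fin.ext ?_
    change (if h : k + m.len < m.len + 1 then (f.1 ⟨k + m.len, h⟩).1
      else n.len + (k + m.len - m.len)) = k + n.len
    split_ifs with h
    · obtain rfl : k = 0 := by omega
      have e := congrArg Fin.val f.2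
      rw [Fin.val_last] at e
      refine Eq.trans ?_ (e.trans (zero_add _).symm)
      exact congrArg (fun i => (f.1 i).1) (Fin.ext (zero_add _))
    · omega⟩

end DeltaTop

/-- The category of strictly positive finite ordinals and order-, first- and
last-element-preserving functions. -/
structure DeltaBotTop where
  len : ℕ

namespace DeltaBotTop

instance : Category DeltaBotTop where
  Hom m n := {f : (⟨m.len⟩ : DeltaTop) ⟶ ⟨n.len⟩ // DeltaTop.PreservesBot f}
  id _ := ⟨𝟙 _, rfl⟩
  comp f g := ⟨f.1 ≫ g.1, (congrArg g.1.1 f.2).trans g.2⟩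

/-- The inclusion of `DeltaBotTop` in `DeltaTop`. -/
def incl : DeltaBotTop ⥤ DeltaTop where
  obj n := ⟨n.len⟩
  map f := f.1

end DeltaBotTop

section TensorPowers

variable {W : Type u₁} [Category.{v₁} W] [MonoidalCategory W]

/-- The tensor power `B^{⊗ n}`. -/
def tensorPow (B : W) : ℕ → W
  | 0 => 𝟙_ W
  | n + 1 => B ⊗ tensorPow B n

/-- The canonical isomorphism `B^{⊗ j} ⊗ B^{⊗ k} ≅ B^{⊗ (j + k)}`. -/
def tensorPowAdd (B : W) : (j k : ℕ) → (tensorPow B j ⊗ tensorPow B k ≅ tensorPow B (k + j))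
  | 0, k => λ_ (tensorPow B k)
  | j + 1, k => α_ B (tensorPow B j) (tensorPow B k) ≪≫
      whiskerLeftIso B (tensorPowAdd B j k)

variable (B : W) [ComonObj B]

/-- The morphism `1_{B^{⊗ r}} ⊗ ε ⊗ 1_{B^{⊗ (n - r)}} : B^{⊗ (n + 1)} ⟶ B^{⊗ n}`. -/
def powCounit : (n : ℕ) → Fin (n + 1) → (tensorPow B (n + 1) ⟶ tensorPow B n)
  | 0, _ => ε[B] ▷ tensorPow B 0 ≫ (λ_ (tensorPow B 0)).hom
  | n + 1, r => Fin.cases (ε[B] ▷ tensorPow B (n + 1) ≫ (λ_ (tensorPow B (n + 1))).hom)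
      (fun r => B ◁ powCounit n r) r

/-- The morphism `1_{B^{⊗ r}} ⊗ δ ⊗ 1_{B^{⊗ (n - r)}} : B^{⊗ (n + 1)} ⟶ B^{⊗ (n + 2)}`. -/
def powComul : (n : ℕ) → Fin (n + 1) → (tensorPow B (n + 1) ⟶ tensorPow B (n + 2))
  | 0, _ => Δ[B] ▷ tensorPow B 0 ≫ (α_ B B (tensorPow B 0)).hom
  | n + 1, r => Fin.cases (Δ[B] ▷ tensorPow B (n + 1) ≫ (α_ B B (tensorPow B (n + 1))).hom)
      (fun r => B ◁ powComul n r) r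

end TensorPowers

/-- A normal lax functor from a category `C` to a 2-category `𝒜` with prescribed values on
objects. -/
@[ext]
structure NormalLaxFunctorOn {C : Type u₁} [Category.{v₁} C] {𝒜 : Type u} [Bicategory.{w, v} 𝒜]
    [Bicategory.Strict 𝒜] (obj : C → 𝒜) where
  map {m n : C} (f : m ⟶ n) : obj m ⟶ obj n
  map_id (m : C) : map (𝟙 m) = 𝟙 (obj m)
  /-- The composition constraint. -/
  mapComp {m n p : C} (f : m ⟶ n) (g : n ⟶ p) : map f ≫ map g ⟶ map (f ≫ g)
  mapComp_id_left {m n : C} (f : m ⟶ n) : IsIdTwoCell (mapComp (𝟙 m) f)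
  mapComp_id_right {m n : C} (f : m ⟶ n) : IsIdTwoCell (mapComp f (𝟙 n))
  mapComp_assoc {m n p q : C} (f : m ⟶ n) (g : n ⟶ p) (h : p ⟶ q) :
    EqTwoCell (mapComp f g ▷ map h ≫ mapComp (f ≫ g) h)
      (map f ◁ mapComp g h ≫ mapComp f (g ≫ h))

/-- The strictly unitary lax functor, in the sense of Mathlib, given by a `NormalLaxFunctorOn`. -/
def NormalLaxFunctorOn.toStrictlyUnitaryLaxFunctor {C : Type u₁} [Category.{v₁} C] {𝒜 : Type u}
    [Bicategory.{w, v} 𝒜] [Bicategory.Strict 𝒜] {obj : C → 𝒜} (F : NormalLaxFunctorOn obj) :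
    StrictlyUnitaryLaxFunctor (LocallyDiscrete C) 𝒜 :=
  StrictlyUnitaryLaxFunctor.mk'
    { obj := fun n => obj n.as
      map := fun f => F.map f.as
      map_id := fun m => F.map_id m.as
      map₂ := fun η => eqToHom (congrArg (fun f => F.map f.as) (LocallyDiscrete.eq_of_hom η))
      map₂_id := fun _ => rfl
      map₂_comp := fun _ _ => by simp
      mapComp := fun f g => F.mapComp f.as g.as
      mapComp_naturality_left := fun {_ _ _ _ _} η g => by
        obtain rfl := LocallyDiscrete.eq_of_hom η
        simp
      mapComp_naturality_right := fun {_ _ _} f {_ _} η => by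
        obtain rfl := LocallyDiscrete.eq_of_hom η
        simp
      map₂_leftUnitor := fun {a _} f => by
        obtain ⟨h, e⟩ := F.mapComp_id_left f.as
        have e' : F.mapComp ((𝟙 a : a ⟶ a) : Discrete _).as f.as = eqToHom h := e
        rw [e', Bicategory.Strict.leftUnitor_eqToIso (F.map f.as)]
        simp
      map₂_rightUnitor := fun {_ b} f => by
        obtain ⟨h, e⟩ := F.mapComp_id_right f.as
        have e' : F.mapComp f.as ((𝟙 b : b ⟶ b) : Discrete _).as = eqToHom h := e
        rw [e', Bicategory.Strict.rightUnitor_eqToIso (F.map f.as)]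
        simp
      map₂_associator := fun f g h => by
        obtain ⟨h₁, h₂, e⟩ := F.mapComp_assoc f.as g.as h.as
        rw [Bicategory.Strict.associator_eqToIso (F.map f.as)]
        refine (Category.assoc _ _ _).symm.trans ((congrArg (· ≫ eqToHom _) e).trans ?_)
        simp }

section Abar

variable {W : Type u₁} [Category.{v₁} W] [MonoidalCategory W]
  {𝒜 : Type u} [Bicategory.{w, v} 𝒜] [Bicategory.Strict 𝒜] [TwoAction W 𝒜]

/-- The value of `Ā` at the ordinal `n + 1` is `A ⋆ B^{⊗ n}`. -/
def abarObj (B : W) (A : 𝒜) (n : DeltaTop) : 𝒜 := A ⊙ᵣ tensorPow B n.len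

/-- The canonical isomorphism from `Ā(m) ⋆ B^{⊗ k}` to `Ā(m ⊕ (k + 1))`. -/
def abarOplus (B : W) (A : 𝒜) (m : DeltaTop) (k : ℕ) :
    abarObj B A m ⊙ᵣ tensorPow B k ⟶ abarObj B A (m.oplus k) :=
  (αᵣ A (tensorPow B m.len) (tensorPow B k)).inv ≫ A ⊴ᵣ (tensorPowAdd B m.len k).hom

/-- The value `γ ⋆ B^{⊗ n} : A ⋆ B^{⊗ n} ⟶ A ⋆ B^{⊗ (n + 1)}` of `Ā` at `∂₀`. -/
def abarDZero (B : W) {A : 𝒜} (γ : A ⟶ A ⊙ᵣ B) (n : ℕ) :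
    abarObj B A ⟨n⟩ ⟶ abarObj B A ⟨n + 1⟩ :=
  γ ⊵ᵣ tensorPow B n ≫ (αᵣ A B (tensorPow B n)).inv

/-- A normal lax functor structure on `Ā`, whose values on objects and generating morphisms are
those determined by `γ` and the comonoid `B`, with identity composition constraints unless neither
factor preserves the first element, and compatible with the right actions of `⊕` on `DeltaTop` and
of `⋆` on `𝒜`. -/
@[ext]
structure NormalLaxAbar (B : W) [ComonObj B] {A : 𝒜} (γ : A ⟶ A ⊙ᵣ B) extends
    NormalLaxFunctorOn (abarObj B A) where
  map_dZero (n : ℕ) : map (DeltaTop.dZero n) = abarDZero B γ n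
  map_dSucc (n : ℕ) (r : Fin (n + 1)) : map (DeltaTop.dSucc n r) = A ⊴ᵣ powComul B n r
  map_s (n : ℕ) (r : Fin (n + 1)) : map (DeltaTop.s n r) = A ⊴ᵣ powCounit B n r
  mapComp_isId {m n p : DeltaTop} (f : m ⟶ n) (g : n ⟶ p)
    (h : DeltaTop.PreservesBot f ∨ DeltaTop.PreservesBot g) : IsIdTwoCell (mapComp f g)
  /-- `Ā(f ⊕ 1)` is `Ā(f) ⋆ B^{⊗ k}`, up to the canonical isomorphisms. -/
  map_oplus {m n : DeltaTop} (f : m ⟶ n) (k : ℕ) :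
    abarOplus B A m k ≫ map (DeltaTop.oplusMap f k) =
      map f ⊵ᵣ tensorPow B k ≫ abarOplus B A n k
  /-- The constraint at `f ⊕ 1` and `g ⊕ 1` is the constraint at `f` and `g`, acted on by
  `B^{⊗ k}`, up to the canonical isomorphisms. -/
  mapComp_oplus {m n p : DeltaTop} (f : m ⟶ n) (g : n ⟶ p) (k : ℕ) :
    EqTwoCell
      (abarOplus B A m k ◁ mapComp (DeltaTop.oplusMap f k) (DeltaTop.oplusMap g k))
      (TwoAction.actionTwo (mapComp f g) (tensorPow B k) ▷ abarOplus B A p k)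

end Abar

/-! Every morphism `f : m ⟶ n` of `DeltaTop` is `dZero m.len ≫ hat f` for a unique bottom-preserving
`hat f`. By `hat_comp` and `hat_eq_of_preservesBot`, this exhibits `DeltaTop` as the coKleisli
category of the comonad `cons` (adjoin a new first element) on the bottom-preserving maps. The
comonoid `B` gives a functor `powMap` from bottom-preserving maps to `W` which turns `cons` into the
comonad `B ⊗ -`, so `hatMap` carries composition in `DeltaTop` to `coKleisliComp`.

From `τ`, a morphism `f` is sent to `γ ⋆ B^{⊗ m}` followed by `A ⋆ hatMap f` (`kleisliMap`), and the
constraint at `(f, g)` is `τ ⋆ B^{⊗ m}` whiskered by `A ⋆ (B ◁ hatMap f ≫ hatMap g)`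
(`kleisliCell`). Lax associativity is then a whiskering of the cocycle condition
(`kleisliCell_assoc`). If `f` or `g` preserves the first element, its `hatMap` factors through the
counit of `B`, and normality of `τ` makes the constraint an identity.

Conversely, given a lax functor `F`, the identity constraints force `F` on bottom-preserving maps
(`map_of_preservesBot`), hence on all 1-cells (`map_eq`). They also reduce every constraint to the
one at `(∂₀, ∂₀)` (`constraint_eq`). Compatibility with the actions reduces that one to the first
ordinal (`constraint_dZero_dZero`), where undoing the action of the unit object gives `τ`. -/

namespace DeltaTop

/-! ### Combinatorics of `DeltaTop`: the comonad `cons` and the coKleisli description of morphisms.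
-/

theorem hom_ext {m n : DeltaTop} {f g : m ⟶ n} (h : ∀ i, (f.1 i).1 = (g.1 i).1) : f = g :=
  Subtype.ext (OrderHom.ext _ _ (funext fun i => Fin.ext (h i)))

@[simp]
theorem comp_val_apply {m n p : DeltaTop} (f : m ⟶ n) (g : n ⟶ p) (i : Fin (m.len + 1)) :
    (f ≫ g).1 i = g.1 (f.1 i) := rfl

@[simp]
theorem id_val_apply (m : DeltaTop) (i : Fin (m.len + 1)) : (𝟙 m : m ⟶ m).1 i = i := rfl

theorem dZero_apply (n : ℕ) (i : Fin (n + 1)) : ((dZero n).1 i).1 = i.1 + 1 := rfl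

theorem dSucc_apply (n : ℕ) (r : Fin (n + 1)) (i : Fin (n + 2)) :
    ((dSucc n r).1 i).1 = if i.1 < r.1 + 1 then i.1 else i.1 + 1 := by
  change (Fin.succAbove r.succ.castSucc i).1 = _
  simp only [Fin.succAbove, Fin.lt_def]
  split_ifs <;> simp_all

theorem s_apply (n : ℕ) (r : Fin (n + 1)) (i : Fin (n + 2)) :
    ((s n r).1 i).1 = if r.1 < i.1 then i.1 - 1 else i.1 := by
  change (Fin.predAbove r i).1 = _
  simp only [Fin.predAbove, Fin.lt_def, Fin.val_castSucc]
  split_ifs <;> rfl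

/-- The morphism which preserves the first element and is a shift of `f` on the others. -/
def cons {m n : DeltaTop} (f : m ⟶ n) : (⟨m.len + 1⟩ : DeltaTop) ⟶ ⟨n.len + 1⟩ :=
  ⟨{ toFun := Fin.cases 0 fun i => (f.1 i).succ
     monotone' := by
      intro i j hij
      induction i using Fin.cases with
      | zero => exact Fin.zero_le _
      | succ i =>
        induction j using Fin.cases with
        | zero => simp at hij
        | succ j =>
          simpa using f.1.monotone (Fin.succ_le_succ_iff.1 hij) },
   by
    exact congrArg Fin.succ f.2⟩

/-- The extension of `f` to the ordinal with a new first element, which is sent to the first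
element. -/
def hat {m n : DeltaTop} (f : m ⟶ n) : (⟨m.len + 1⟩ : DeltaTop) ⟶ n :=
  ⟨{ toFun := Fin.cases 0 f.1
     monotone' := by
      intro i j hij
      induction i using Fin.cases with
      | zero => exact Fin.zero_le _
      | succ i =>
        induction j using Fin.cases with
        | zero => simp at hij
        | succ j => simpa using f.1.monotone (Fin.succ_le_succ_iff.1 hij) },
   by
    exact f.2⟩

section

variable {m n p : DeltaTop}

@[simp]
theorem cons_zero (f : m ⟶ n) : (cons f).1 0 = 0 := rfl

@[simp]
theorem cons_succ (f : m ⟶ n) (i : Fin (m.len + 1)) : (cons f).1 i.succ = (f.1 i).succ := rfl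

theorem oplusMap_apply (f : m ⟶ n) (k : ℕ) (i : Fin ((m.oplus k).len + 1)) :
    ((oplusMap f k).1 i).1 =
      if h : i.1 < m.len + 1 then (f.1 ⟨i.1, h⟩).1 else n.len + (i.1 - m.len) := rfl

theorem val_congr (f : m ⟶ n) {i j : Fin (m.len + 1)} (h : i.1 = j.1) :
    (f.1 i).1 = (f.1 j).1 := by
  rw [Fin.ext h]

theorem val_le (f : m ⟶ n) {i j : Fin (m.len + 1)} (h : i.1 ≤ j.1) :
    (f.1 i).1 ≤ (f.1 j).1 := f.1.monotone h

theorem hom_ext_succ {m : ℕ} {f g : (⟨m + 1⟩ : DeltaTop) ⟶ n} (h₀ : f.1 0 = g.1 0)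
    (h : ∀ i : Fin (m + 1), f.1 i.succ = g.1 i.succ) : f = g :=
  hom_ext fun i => congrArg Fin.val (Fin.cases h₀ h i)

theorem preservesBot_id (m : DeltaTop) : PreservesBot (𝟙 m) := rfl

theorem PreservesBot.comp {f : m ⟶ n} {g : n ⟶ p} (hf : PreservesBot f) (hg : PreservesBot g) :
    PreservesBot (f ≫ g) := (congrArg g.1 hf).trans hg

theorem preservesBot_cons (f : m ⟶ n) : PreservesBot (cons f) := rfl

theorem preservesBot_hat (f : m ⟶ n) : PreservesBot (hat f) := rfl

theorem preservesBot_s (n : ℕ) (r : Fin (n + 1)) : PreservesBot (s n r) :=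
  Fin.ext (by simp [s_apply])

theorem preservesBot_dSucc (n : ℕ) (r : Fin (n + 1)) : PreservesBot (dSucc n r) :=
  Fin.ext (by simp [dSucc_apply])

theorem cons_id (m : DeltaTop) : cons (𝟙 m) = 𝟙 (⟨m.len + 1⟩ : DeltaTop) :=
  hom_ext_succ rfl fun _ => rfl

theorem cons_comp (f : m ⟶ n) (g : n ⟶ p) : cons (f ≫ g) = cons f ≫ cons g :=
  hom_ext_succ rfl fun _ => rfl

theorem dZero_comp_s_zero (n : ℕ) : dZero n ≫ s n 0 = 𝟙 _ :=
  hom_ext fun i => by simp [s_apply, dZero_apply]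

theorem dSucc_zero_zero (n : ℕ) : (dSucc n 0).1 0 = 0 := preservesBot_dSucc n 0

theorem dSucc_zero_succ (n : ℕ) (i : Fin (n + 1)) : (dSucc n 0).1 i.succ = i.succ.succ :=
  Fin.ext (by simp [dSucc_apply])

theorem s_zero_zero (n : ℕ) : (s n 0).1 0 = 0 := preservesBot_s n 0

theorem s_zero_succ (n : ℕ) (i : Fin (n + 1)) : (s n 0).1 i.succ = i :=
  Fin.ext (by simp [s_apply])

/-- The adjoined first element has the same image as the old one, so the two may be merged
beforehand. In coKleisli terms, bottom-preserving maps are those that factor through the counit `s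
m.len 0`. -/
theorem hat_eq_of_preservesBot {f : m ⟶ n} (hf : PreservesBot f) : hat f = s m.len 0 ≫ f :=
  hom_ext_succ (by rw [comp_val_apply, s_zero_zero]; exact hf.symm)
    fun i => by rw [comp_val_apply, s_zero_succ]; rfl

/-- The coKleisli composition law, with `dSucc m.len 0` as comultiplication of `cons`. -/
theorem hat_comp (f : m ⟶ n) (g : n ⟶ p) :
    hat (f ≫ g) = dSucc m.len 0 ≫ cons (hat f) ≫ hat g :=
  hom_ext_succ (by rw [comp_val_apply, dSucc_zero_zero]; rfl)
    fun i => by rw [comp_val_apply, dSucc_zero_succ]; rfl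

theorem dSucc_succ (n : ℕ) (r : Fin (n + 1)) : dSucc (n + 1) r.succ = cons (dSucc n r) :=
  hom_ext_succ (preservesBot_dSucc _ _) fun i => Fin.ext (by
    refine (dSucc_apply _ _ _).trans (Eq.trans ?_ (congrArg (· + 1) (dSucc_apply n r i)).symm)
    simp only [Fin.val_succ]
    split_ifs <;> omega)

theorem s_succ (n : ℕ) (r : Fin (n + 1)) : s (n + 1) r.succ = cons (s n r) :=
  hom_ext_succ (preservesBot_s _ _) fun i => Fin.ext (by
    refine (s_apply _ _ _).trans (Eq.trans ?_ (congrArg (· + 1) (s_apply n r i)).symm)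
    simp only [Fin.val_succ]
    split_ifs <;> omega)

theorem oplusMap_comp (f : m ⟶ n) (g : n ⟶ p) (k : ℕ) :
    oplusMap (f ≫ g) k = oplusMap f k ≫ oplusMap g k :=
  hom_ext fun i => by
    have hi : i.1 < k + m.len + 1 := i.2
    have key := oplusMap_apply f k i
    refine (oplusMap_apply _ _ _).trans (Eq.trans ?_ (oplusMap_apply g k _).symm)
    by_cases h : i.1 < m.len + 1
    · rw [dif_pos h] at key ⊢
      have := (f.1 ⟨i.1, h⟩).2
      rw [dif_pos (by omega)]
      exact val_congr g key.symm
    · rw [dif_neg h] at key ⊢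
      by_cases h' : ((oplusMap f k).1 i).1 < n.len + 1
      · omega
      · rw [dif_neg h']
        omega

theorem oplusMap_cons (f : m ⟶ n) (k : ℕ) : oplusMap (cons f) k = cons (oplusMap f k) :=
  hom_ext_succ rfl fun i => Fin.ext (by
    refine (oplusMap_apply _ _ _).trans
      (Eq.trans ?_ (congrArg (· + 1) (oplusMap_apply f k i)).symm)
    simp only [Fin.val_succ]
    split_ifs with h₁ h₂ h₂
    · rfl
    · omega
    · omega
    · omega)

theorem oplusMap_hat (f : m ⟶ n) (k : ℕ) : oplusMap (hat f) k = hat (oplusMap f k) :=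
  hom_ext_succ rfl fun i => Fin.ext (by
    refine (oplusMap_apply _ _ _).trans (Eq.trans ?_ (oplusMap_apply f k i).symm)
    simp only [Fin.val_succ]
    split_ifs with h₁ h₂ h₂
    · rfl
    · omega
    · omega
    · omega)

theorem oplusMap_id (m : DeltaTop) (k : ℕ) : oplusMap (𝟙 m) k = 𝟙 (m.oplus k) :=
  hom_ext fun i => by
    refine (oplusMap_apply _ _ _).trans ?_
    split_ifs with h
    · rfl
    · change _ = i.1
      omega

theorem oplusMap_dZero (n k : ℕ) : oplusMap (dZero n) k = dZero (k + n) :=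
  hom_ext fun i => by
    refine (oplusMap_apply _ _ _).trans (Eq.trans ?_ (dZero_apply _ _).symm)
    split_ifs with h
    · rfl
    · change n + 1 + (i.1 - n) = _
      change ¬ i.1 < n + 1 at h
      omega

theorem oplusMap_s_zero (n k : ℕ) : oplusMap (s n 0) k = s (k + n) 0 := by
  have h : s n 0 = hat (𝟙 ⟨n⟩) := (hat_eq_of_preservesBot (preservesBot_id _)).symm
  rw [h, oplusMap_hat, oplusMap_id, hat_eq_of_preservesBot (preservesBot_id _)]
  rfl

theorem oplusMap_dSucc_zero (n k : ℕ) : oplusMap (dSucc n 0) k = dSucc (k + n) 0 := by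
  -- Writing the comultiplication through `hat` and `dZero` reduces the claim to the compatibilities
  -- of `oplusMap` already known.
  have h (n : ℕ) : dSucc n 0 = hat (dZero n ≫ dZero (n + 1)) :=
    hom_ext_succ (preservesBot_dSucc _ _) fun i => dSucc_zero_succ n i
  rw [h, oplusMap_hat, oplusMap_comp, oplusMap_dZero, oplusMap_dZero, h]
  rfl

end

end DeltaTop

/-! ### Unique normal forms for bottom-preserving maps. -/

/-- Normal forms for the morphisms of `DeltaTop` that preserve the first element. -/
inductive BotPath : ℕ → ℕ → Type
  | nil : BotPath 0 0
  /-- Precompose with `σ₀`. -/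
  | del {m n : ℕ} (p : BotPath m n) : BotPath (m + 1) n
  /-- Enlarge by one the gap between the images of `0` and `1`. -/
  | dup {m n : ℕ} (p : BotPath (m + 1) n) : BotPath (m + 1) (n + 1)

namespace BotPath

open DeltaTop

/-- The morphism represented by a normal form. -/
def toHom : {m n : ℕ} → BotPath m n → ((⟨m⟩ : DeltaTop) ⟶ ⟨n⟩)
  | _, _, nil => 𝟙 _
  | _, _, del (m := m) p => s m 0 ≫ p.toHom
  | _, _, dup (m := m) p => dSucc m 0 ≫ DeltaTop.cons p.toHom

theorem preservesBot_toHom : {m n : ℕ} → (p : BotPath m n) → PreservesBot p.toHom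
  | _, _, nil => rfl
  | _, _, del p => (preservesBot_s _ _).comp p.preservesBot_toHom
  | _, _, dup _ => (preservesBot_dSucc _ _).comp (preservesBot_cons _)

/-- The collapse `s n 0` closes the gap that `dup` opens, so `dup` can be undone. This also gives
the rule for composing `dup` with `del`. -/
theorem dup_comp_s {m n : ℕ} (f : (⟨m + 1⟩ : DeltaTop) ⟶ ⟨n⟩) (hf : PreservesBot f) :
    (dSucc m 0 ≫ DeltaTop.cons f) ≫ s n 0 = f :=
  hom_ext_succ (by
      rw [comp_val_apply, comp_val_apply, dSucc_zero_zero]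
      exact (s_zero_zero n).trans hf.symm)
    fun i => by
      rw [comp_val_apply, comp_val_apply, dSucc_zero_succ]
      exact s_zero_succ n _

/-- The two recursive cases are decided by the image of `1`. If it is `0`, then `f` factors through
`s m 0`. Otherwise there is a gap above `0`, which composing with `s n 0` narrows by one. Either way
`m + n` drops. -/
theorem toHom_surjective : (N : ℕ) → ∀ {m n : ℕ} (f : (⟨m⟩ : DeltaTop) ⟶ ⟨n⟩),
    PreservesBot f → m + n = N → ∃ p : BotPath m n, p.toHom = f
  | N, 0, n, f, hf, hN => by
    have h : (0 : Fin (n + 1)) = Fin.last n := hf.symm.trans f.2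
    obtain rfl : n = 0 := (congrArg Fin.val h).symm
    exact ⟨nil, hom_ext fun i => by
      have h₁ := (f.1 i).2
      have h₂ : i.1 < 1 := i.2
      change (f.1 i).1 < 1 at h₁
      change i.1 = _
      omega⟩
  | N, m + 1, n, f, hf, hN => by
    by_cases h : f.1 (Fin.succ 0) = 0
    · obtain ⟨p, hp⟩ := toHom_surjective (m + n) (dZero m ≫ f) h rfl
      refine ⟨del p, ?_⟩
      rw [toHom, hp]
      exact hom_ext_succ (by rw [comp_val_apply, s_zero_zero]; exact h.trans hf.symm)
        fun i => by rw [comp_val_apply, s_zero_succ]; rfl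
    · cases n with
      | zero => exact absurd (Subsingleton.elim (α := Fin 1) _ _) h
      | succ n =>
        obtain ⟨p, hp⟩ :=
          toHom_surjective (m + 1 + n) (f ≫ s n 0) (hf.comp (preservesBot_s _ _)) rfl
        refine ⟨dup p, ?_⟩
        rw [toHom, hp]
        refine hom_ext_succ (by rw [comp_val_apply, dSucc_zero_zero]; exact hf.symm) fun i => ?_
        rw [comp_val_apply, dSucc_zero_succ, cons_succ]
        refine Fin.ext ((congrArg (· + 1) (s_apply n 0 _)).trans ?_)
        have h₁ : (f.1 (Fin.succ 0)).1 ≤ (f.1 i.succ).1 := val_le f (by simp)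
        have h₂ : (f.1 (Fin.succ 0)).1 ≠ 0 := fun e => h (Fin.ext e)
        change (if 0 < (f.1 i.succ).1 then (f.1 i.succ).1 - 1 else (f.1 i.succ).1) + 1 = _
        split_ifs <;> omega
  termination_by N => N

theorem exists_toHom_eq {m n : DeltaTop} (f : m ⟶ n) (hf : PreservesBot f) :
    ∃ p : BotPath m.len n.len, p.toHom = f :=
  toHom_surjective _ f hf rfl

/-- The outermost constructor can be read off the morphism: `1` goes to `0` for `del` and to a
successor for `dup`. It is then stripped using the section `dZero` of `s m 0`, or the retraction of
`dup_comp_s`. -/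
theorem toHom_injective : {m n : ℕ} → (p q : BotPath m n) → p.toHom = q.toHom → p = q
  | _, _, nil, nil, _ => rfl
  | _, _, del (m := m) p, del q, h => by
    have h' := congrArg (dZero m ≫ ·) h
    simp only [toHom] at h'
    rw [← Category.assoc, ← Category.assoc, dZero_comp_s_zero, Category.id_comp,
      Category.id_comp] at h'
    rw [toHom_injective p q h']
  | _, _, dup p, dup q, h => by
    have h' := congrArg (· ≫ s _ 0) h
    simp only [toHom] at h'
    rw [dup_comp_s _ p.preservesBot_toHom, dup_comp_s _ q.preservesBot_toHom] at h'
    rw [toHom_injective p q h']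
  | _, _, del (m := m) p, dup q, h => by
    have h' : p.toHom.1 ((s m 0).1 (Fin.succ 0)) =
        (DeltaTop.cons q.toHom).1 ((dSucc m 0).1 (Fin.succ 0)) :=
      congrArg (fun f => f.1 (Fin.succ 0)) h
    rw [s_zero_succ, dSucc_zero_succ, cons_succ] at h'
    exact absurd (p.preservesBot_toHom.symm.trans h').symm (Fin.succ_ne_zero _)
  | _, _, dup (m := m) q, del p, h => by
    have h' : p.toHom.1 ((s m 0).1 (Fin.succ 0)) =
        (DeltaTop.cons q.toHom).1 ((dSucc m 0).1 (Fin.succ 0)) :=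
      congrArg (fun f => f.1 (Fin.succ 0)) h.symm
    rw [s_zero_succ, dSucc_zero_succ, cons_succ] at h'
    exact absurd (p.preservesBot_toHom.symm.trans h').symm (Fin.succ_ne_zero _)

/-- The normal form of an identity. -/
def id : (n : ℕ) → BotPath n n
  | 0 => nil
  | n + 1 => dup (del (id n))

/-- Composition of normal forms. -/
def comp : {m n p : ℕ} → BotPath m n → BotPath n p → BotPath m p
  | _, _, _, nil, q => q
  | _, _, _, del p, q => del (comp p q)
  | _, _, _, dup p, del q => comp p q
  | _, _, _, dup p, dup q => dup (comp (dup p) q)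

/-- The normal form of `f ⊕ 1`. -/
def oplus (k : ℕ) : {m n : ℕ} → BotPath m n → BotPath (k + m) (k + n)
  | _, _, nil => id k
  | _, _, del p => del (oplus k p)
  | _, _, dup p => dup (oplus k p)

/-- A counit law of the comonad `cons`. It shows that `dup (del p)` is a normal form of `cons
p.toHom`. -/
theorem dSucc_zero_comp_cons_s_zero_comp {m n : ℕ} (f : (⟨m⟩ : DeltaTop) ⟶ ⟨n⟩) :
    dSucc m 0 ≫ DeltaTop.cons (s m 0 ≫ f) = DeltaTop.cons f :=
  hom_ext_succ (by rw [comp_val_apply, dSucc_zero_zero]; rfl) fun i => by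
    rw [comp_val_apply, dSucc_zero_succ, cons_succ, comp_val_apply, s_zero_succ]; rfl

theorem toHom_id : (n : ℕ) → (id n).toHom = 𝟙 _
  | 0 => rfl
  | n + 1 => by
    rw [id, toHom, toHom, dSucc_zero_comp_cons_s_zero_comp, toHom_id n, cons_id]

theorem toHom_comp : {m n p : ℕ} → (x : BotPath m n) → (y : BotPath n p) →
    (x.comp y).toHom = x.toHom ≫ y.toHom
  | _, _, _, nil, q => by rw [comp, toHom, Category.id_comp]
  | _, _, _, del p, q => by rw [comp, toHom, toHom, toHom_comp p q, Category.assoc]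
  | _, _, _, dup p, del q => by
    rw [comp, toHom_comp p q]
    conv_rhs => rw [toHom, toHom, ← Category.assoc, dup_comp_s _ p.preservesBot_toHom]
  | _, _, _, dup p, dup q => by
    rw [comp, toHom, toHom_comp (dup p) q]
    simp only [toHom]
    refine hom_ext_succ ?_ fun i => ?_
    · simp only [comp_val_apply, dSucc_zero_zero, cons_zero]
    · simp only [comp_val_apply, dSucc_zero_succ, cons_succ]

theorem toHom_oplus (k : ℕ) : {m n : ℕ} → (p : BotPath m n) →
    (p.oplus k).toHom = oplusMap p.toHom k
  | _, _, nil => (toHom_id k).trans (oplusMap_id ⟨0⟩ k).symm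
  | _, _, del p => by
    rw [oplus, toHom, toHom, toHom_oplus k p, oplusMap_comp, oplusMap_s_zero]; rfl
  | _, _, dup p => by
    rw [oplus, toHom, toHom, toHom_oplus k p, oplusMap_comp, oplusMap_dSucc_zero, oplusMap_cons]
    rfl

end BotPath

/-! ### The functor from bottom-preserving maps to tensor powers of the comonoid `B`. -/

section PowMap

variable {W : Type u₁} [Category.{v₁} W] [MonoidalCategory W] (B : W) [ComonObj B]

/-- The counit of `B` on the first factor of `B ⊗ X`. -/
def headCounit (X : W) : B ⊗ X ⟶ X := ε[B] ▷ X ≫ (λ_ X).hom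

/-- The comultiplication of `B` on the first factor of `B ⊗ X`. -/
def headComul (X : W) : B ⊗ X ⟶ B ⊗ B ⊗ X := Δ[B] ▷ X ≫ (α_ B B X).hom

theorem powCounit_zero (n : ℕ) : powCounit B n 0 = headCounit B (tensorPow B n) := by
  cases n <;> rfl

theorem powComul_zero (n : ℕ) : powComul B n 0 = headComul B (tensorPow B n) := by
  cases n <;> rfl

theorem powCounit_succ (n : ℕ) (r : Fin (n + 1)) :
    powCounit B (n + 1) r.succ = B ◁ powCounit B n r := rfl

theorem powComul_succ (n : ℕ) (r : Fin (n + 1)) :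
    powComul B (n + 1) r.succ = B ◁ powComul B n r := rfl

variable {X Y : W}

theorem headCounit_naturality (f : X ⟶ Y) :
    B ◁ f ≫ headCounit B Y = headCounit B X ≫ f := by
  simp [headCounit, MonoidalCategory.whisker_exchange_assoc]

theorem headComul_naturality (f : X ⟶ Y) :
    B ◁ f ≫ headComul B Y = headComul B X ≫ B ◁ B ◁ f := by
  simp [headComul, MonoidalCategory.whisker_exchange_assoc]

theorem headComul_headCounit (X : W) : headComul B X ≫ headCounit B (B ⊗ X) = 𝟙 _ := by
  have h : Δ[B] ▷ X ≫ (ε[B] ▷ B) ▷ X ≫ ((λ_ B).hom) ▷ X = 𝟙 _ := by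
    rw [← MonoidalCategory.comp_whiskerRight, ← MonoidalCategory.comp_whiskerRight]
    simp
  rw [← h]
  simp [headComul, headCounit]

theorem headComul_whiskerLeft_headCounit (X : W) : headComul B X ≫ B ◁ headCounit B X = 𝟙 _ := by
  have h : Δ[B] ▷ X ≫ (B ◁ ε[B]) ▷ X ≫ ((ρ_ B).hom) ▷ X = 𝟙 _ := by
    rw [← MonoidalCategory.comp_whiskerRight, ← MonoidalCategory.comp_whiskerRight]
    simp
  rw [← h]
  simp [headComul, headCounit]

theorem headComul_headComul (X : W) :
    headComul B X ≫ headComul B (B ⊗ X) = headComul B X ≫ B ◁ headComul B X := by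
  have h : Δ[B] ▷ X ≫ (B ◁ Δ[B]) ▷ X ≫ (α_ B (B ⊗ B) X).hom ≫ B ◁ (α_ B B X).hom =
      Δ[B] ▷ X ≫ (Δ[B] ▷ B) ▷ X ≫ (α_ B B B).hom ▷ X ≫
        (α_ B (B ⊗ B) X).hom ≫ B ◁ (α_ B B X).hom := by
    rw [← MonoidalCategory.comp_whiskerRight_assoc, ComonObj.comul_assoc]
    simp
  simp only [headComul, MonoidalCategory.whiskerLeft_comp, Category.assoc]
  simp only [MonoidalCategory.whisker_assoc, Category.assoc, Iso.inv_hom_id_assoc] at h ⊢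
  simpa using h.symm

theorem headComul_whiskerLeft_headCounit_comp (f : X ⟶ Y) :
    headComul B X ≫ B ◁ (headCounit B X ≫ f) = B ◁ f := by
  rw [MonoidalCategory.whiskerLeft_comp, ← Category.assoc, headComul_whiskerLeft_headCounit,
    Category.id_comp]

/-- The image in `W` of the rule for `dup` followed by `del`; it needs only a counit law and
naturality. The next lemma treats `dup` followed by `dup` by coassociativity. -/
theorem headComul_comp_headCounit_comp {Z : W} (f : B ⊗ X ⟶ Y) (g : Y ⟶ Z) :
    (headComul B X ≫ B ◁ f) ≫ headCounit B Y ≫ g = f ≫ g := by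
  have h := headCounit_naturality B f
  have h' := headComul_headCounit B X
  rw [Category.assoc, reassoc_of% h, reassoc_of% h']

theorem headComul_comp_headComul_comp {Z : W} (f : B ⊗ X ⟶ Y) (g : B ⊗ Y ⟶ Z) :
    (headComul B X ≫ B ◁ f) ≫ headComul B Y ≫ B ◁ g =
      headComul B X ≫ B ◁ ((headComul B X ≫ B ◁ f) ≫ g) := by
  have h := headComul_naturality B f
  have h' := headComul_headComul B X
  simp only [MonoidalCategory.whiskerLeft_comp, Category.assoc]
  rw [reassoc_of% h, reassoc_of% h']

theorem assoc_comp_headCounit_comp (V : W) {X' Y' : W} (a : X ⊗ V ⟶ X') (b : Y ⊗ V ⟶ Y')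
    (f : X ⟶ Y) (g : X' ⟶ Y') (h : a ≫ g = f ▷ V ≫ b) :
    ((α_ B X V).hom ≫ B ◁ a) ≫ headCounit B X' ≫ g = (headCounit B X ≫ f) ▷ V ≫ b := by
  have h₁ := headCounit_naturality B a
  rw [Category.assoc, reassoc_of% h₁, h]
  simp [headCounit]

theorem assoc_comp_headComul_comp (V : W) {X' Y' : W} (a : (B ⊗ X) ⊗ V ⟶ B ⊗ X') (b : Y ⊗ V ⟶ Y')
    (c : X ⊗ V ⟶ X') (hc : a = (α_ B X V).hom ≫ B ◁ c)
    (f : B ⊗ X ⟶ Y) (g : B ⊗ X' ⟶ Y') (h : a ≫ g = f ▷ V ≫ b) :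
    a ≫ headComul B X' ≫ B ◁ g =
      (headComul B X ≫ B ◁ f) ▷ V ≫ (α_ B Y V).hom ≫ B ◁ b := by
  have h₁ := headComul_naturality B c
  have h₂ : headComul B X ▷ V ≫ (α_ B (B ⊗ X) V).hom ≫ B ◁ a =
      a ≫ headComul B X' := by
    rw [hc, Category.assoc, h₁]
    simp [headComul]
  have h₃ := congrArg (B ◁ ·) h
  simp only [MonoidalCategory.whiskerLeft_comp] at h₃
  rw [← reassoc_of% h₂, h₃]
  simp

namespace BotPath

/-- The morphism of tensor powers of `B` induced by a normal form. -/
def eval : {m n : ℕ} → BotPath m n → (tensorPow B m ⟶ tensorPow B n)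
  | _, _, nil => 𝟙 _
  | _, _, del (m := m) p => headCounit B (tensorPow B m) ≫ p.eval
  | _, _, dup (m := m) p => headComul B (tensorPow B m) ≫ B ◁ p.eval

theorem eval_dup_del {m n : ℕ} (p : BotPath m n) : (dup (del p)).eval B = B ◁ p.eval B := by
  exact headComul_whiskerLeft_headCounit_comp B _

theorem eval_id : (n : ℕ) → (id n).eval B = 𝟙 _
  | 0 => rfl
  | n + 1 => by
    rw [id, eval_dup_del, eval_id n]
    exact MonoidalCategory.whiskerLeft_id _ _

/-- The recursion defining `comp` uses only the identities valid in any comonad, so it can be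
followed in `W`. No presentation of the category by generators and relations is needed. -/
theorem eval_comp : {m n p : ℕ} → (x : BotPath m n) → (y : BotPath n p) →
    (x.comp y).eval B = x.eval B ≫ y.eval B
  | _, _, _, nil, q => by rw [comp]; exact (Category.id_comp _).symm
  | _, _, _, del p, q => by
    rw [comp, eval, eval_comp p q]
    exact (Category.assoc _ _ _).symm
  | _, _, _, dup p, del q => by
    rw [comp, eval_comp p q]
    exact (headComul_comp_headCounit_comp B _ _).symm
  | _, _, _, dup p, dup q => by
    rw [comp, eval, eval_comp (dup p) q]
    exact (headComul_comp_headComul_comp B _ _).symm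

theorem tensorPowAdd_comp_eval_oplus (k : ℕ) : {m n : ℕ} → (p : BotPath m n) →
    (tensorPowAdd B m k).hom ≫ (p.oplus k).eval B =
      p.eval B ▷ tensorPow B k ≫ (tensorPowAdd B n k).hom
  | _, _, nil => by
    refine (congrArg (_ ≫ ·) (eval_id B k)).trans ((Category.comp_id _).trans ?_)
    exact ((congrArg (· ≫ _) (MonoidalCategory.id_whiskerRight _ _)).trans
      (Category.id_comp _)).symm
  | _, _, del p => assoc_comp_headCounit_comp B _ _ _ _ _ (tensorPowAdd_comp_eval_oplus k p)
  | _, _, dup p => assoc_comp_headComul_comp B _ _ _ _ rfl _ _ (tensorPowAdd_comp_eval_oplus k p)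

end BotPath

namespace DeltaTop

variable {m n p : DeltaTop}

/-- The morphism of tensor powers induced by a morphism that preserves the first element. -/
noncomputable def powMap (f : m ⟶ n) (hf : PreservesBot f) :
    tensorPow B m.len ⟶ tensorPow B n.len :=
  (BotPath.exists_toHom_eq f hf).choose.eval B

/-- Uniqueness of normal forms makes the choice in `powMap` immaterial. -/
theorem powMap_toHom {m n : ℕ} (p : BotPath m n) (f : (⟨m⟩ : DeltaTop) ⟶ ⟨n⟩)
    (hf : PreservesBot f) (h : p.toHom = f) : powMap B f hf = p.eval B :=
  congrArg (BotPath.eval B)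
    (BotPath.toHom_injective _ _ ((BotPath.exists_toHom_eq f hf).choose_spec.trans h.symm))

theorem powMap_id (h : PreservesBot (𝟙 m)) : powMap B (𝟙 m) h = 𝟙 _ :=
  (powMap_toHom B _ _ _ (BotPath.toHom_id _)).trans (BotPath.eval_id B _)

theorem powMap_comp (f : m ⟶ n) (g : n ⟶ p) (hf : PreservesBot f) (hg : PreservesBot g)
    (h : PreservesBot (f ≫ g)) : powMap B (f ≫ g) h = powMap B f hf ≫ powMap B g hg := by
  obtain ⟨x, hx⟩ := BotPath.exists_toHom_eq f hf
  obtain ⟨y, hy⟩ := BotPath.exists_toHom_eq g hg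
  rw [powMap_toHom B x f hf hx, powMap_toHom B y g hg hy, ← BotPath.eval_comp]
  exact powMap_toHom B _ _ _ ((BotPath.toHom_comp x y).trans (by rw [hx, hy]))

theorem powMap_cons (f : m ⟶ n) (hf : PreservesBot f) (h : PreservesBot (cons f)) :
    powMap B (cons f) h = B ◁ powMap B f hf := by
  obtain ⟨x, hx⟩ := BotPath.exists_toHom_eq f hf
  rw [powMap_toHom B x f hf hx, ← BotPath.eval_dup_del]
  refine powMap_toHom B _ _ _ ?_
  rw [BotPath.toHom, BotPath.toHom, BotPath.dSucc_zero_comp_cons_s_zero_comp, hx]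

theorem powMap_dSucc (n : ℕ) (r : Fin (n + 1)) (h : PreservesBot (dSucc n r)) :
    powMap B (dSucc n r) h = powComul B n r := by
  induction n with
  | zero =>
    obtain rfl : r = 0 := Subsingleton.elim (α := Fin 1) _ _
    rw [powComul_zero]
    refine (powMap_toHom B (.dup (.id 1)) _ _ ?_).trans ?_
    · rw [BotPath.toHom, BotPath.toHom_id, cons_id]; rfl
    · rw [BotPath.eval, BotPath.eval_id]
      exact (congrArg (_ ≫ ·) (MonoidalCategory.whiskerLeft_id _ _)).trans (Category.comp_id _)
  | succ n ih =>
    induction r using Fin.cases with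
    | zero =>
      rw [powComul_zero]
      refine (powMap_toHom B (.dup (.id (n + 2))) _ _ ?_).trans ?_
      · rw [BotPath.toHom, BotPath.toHom_id, cons_id]; rfl
      · rw [BotPath.eval, BotPath.eval_id]
        exact (congrArg (_ ≫ ·) (MonoidalCategory.whiskerLeft_id _ _)).trans (Category.comp_id _)
    | succ r =>
      -- For `r + 1` the generator is `cons` of the one for `r`, and `cons` becomes `B ◁ -`.
      rw [powComul_succ, ← ih r (preservesBot_dSucc _ _), ← powMap_cons B _ _ (preservesBot_cons _)]
      congr 1
      exact dSucc_succ n r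

theorem powMap_s (n : ℕ) (r : Fin (n + 1)) (h : PreservesBot (s n r)) :
    powMap B (s n r) h = powCounit B n r := by
  induction n with
  | zero =>
    obtain rfl : r = 0 := Subsingleton.elim (α := Fin 1) _ _
    rw [powCounit_zero]
    refine (powMap_toHom B (.del (.id 0)) _ _ ?_).trans ?_
    · rw [BotPath.toHom, BotPath.toHom_id]; rfl
    · rw [BotPath.eval, BotPath.eval_id]
      exact Category.comp_id _
  | succ n ih =>
    induction r using Fin.cases with
    | zero =>
      rw [powCounit_zero]
      refine (powMap_toHom B (.del (.id (n + 1))) _ _ ?_).trans ?_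
      · rw [BotPath.toHom, BotPath.toHom_id]; rfl
      · rw [BotPath.eval, BotPath.eval_id]
        exact Category.comp_id _
    | succ r =>
      rw [powCounit_succ, ← ih r (preservesBot_s _ _), ← powMap_cons B _ _ (preservesBot_cons _)]
      congr 1
      exact s_succ n r

theorem tensorPowAdd_comp_powMap_oplusMap (f : m ⟶ n) (hf : PreservesBot f) (k : ℕ)
    (h : PreservesBot (oplusMap f k)) :
    (tensorPowAdd B m.len k).hom ≫ powMap B (oplusMap f k) h =
      powMap B f hf ▷ tensorPow B k ≫ (tensorPowAdd B n.len k).hom := by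
  obtain ⟨x, hx⟩ := BotPath.exists_toHom_eq f hf
  rw [powMap_toHom B x f hf hx, ← BotPath.tensorPowAdd_comp_eval_oplus]
  exact congrArg (_ ≫ ·) (powMap_toHom B _ _ _ ((BotPath.toHom_oplus k x).trans (by rw [hx])))

/-- The class of composites of the generators that preserve the first element. -/
inductive IsGenerated : {m n : DeltaTop} → (m ⟶ n) → Prop
  | id (m : DeltaTop) : IsGenerated (𝟙 m)
  | comp_dSucc {m : DeltaTop} {n : ℕ} (f : m ⟶ ⟨n + 1⟩) (r : Fin (n + 1)) :
      IsGenerated f → IsGenerated (f ≫ dSucc n r)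
  | comp_s {m : DeltaTop} {n : ℕ} (f : m ⟶ ⟨n + 1⟩) (r : Fin (n + 1)) :
      IsGenerated f → IsGenerated (f ≫ s n r)

theorem IsGenerated.comp {f : m ⟶ n} {g : n ⟶ p} (hf : IsGenerated f) (hg : IsGenerated g) :
    IsGenerated (f ≫ g) := by
  induction hg with
  | id => rwa [Category.comp_id]
  | comp_dSucc g r _ ih => rw [← Category.assoc]; exact .comp_dSucc _ _ ih
  | comp_s g r _ ih => rw [← Category.assoc]; exact .comp_s _ _ ih

theorem IsGenerated.cons {f : m ⟶ n} (hf : IsGenerated f) : IsGenerated (cons f) := by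
  induction hf with
  | id => rw [cons_id]; exact .id _
  | comp_dSucc g r _ ih => rw [cons_comp, ← dSucc_succ]; exact .comp_dSucc _ _ ih
  | comp_s g r _ ih => rw [cons_comp, ← s_succ]; exact .comp_s _ _ ih

theorem isGenerated_dSucc (n : ℕ) (r : Fin (n + 1)) : IsGenerated (dSucc n r) := by
  rw [← Category.id_comp (dSucc n r)]; exact .comp_dSucc _ _ (.id _)

theorem isGenerated_s (n : ℕ) (r : Fin (n + 1)) : IsGenerated (s n r) := by
  rw [← Category.id_comp (s n r)]; exact .comp_s _ _ (.id _)

theorem isGenerated_toHom : {m n : ℕ} → (p : BotPath m n) → IsGenerated p.toHom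
  | _, _, .nil => .id _
  | _, _, .del p => (isGenerated_s _ _).comp (isGenerated_toHom p)
  | _, _, .dup p => (isGenerated_dSucc _ _).comp (isGenerated_toHom p).cons

/-- Allows a lax functor to be computed on bottom-preserving maps from its values on the generators.
-/
theorem isGenerated_of_preservesBot (f : m ⟶ n) (hf : PreservesBot f) : IsGenerated f := by
  obtain ⟨p, rfl⟩ := BotPath.exists_toHom_eq f hf
  exact isGenerated_toHom p

theorem IsGenerated.preservesBot {f : m ⟶ n} (hf : IsGenerated f) : PreservesBot f := by
  induction hf with
  | id => rfl
  | comp_dSucc g r _ ih => exact ih.comp (preservesBot_dSucc _ _)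
  | comp_s g r _ ih => exact ih.comp (preservesBot_s _ _)

end DeltaTop

end PowMap

/-! ### Calculus of bundled 2-cells, in which coherence transports disappear. -/

/-- A 2-cell together with its source and target. -/
structure TwoCell {𝒜 : Type u} [Bicategory.{w, v} 𝒜] (X Y : 𝒜) where
  src : X ⟶ Y
  tgt : X ⟶ Y
  hom : src ⟶ tgt

namespace TwoCell

section Basic

variable {𝒜 : Type u} [Bicategory.{w, v} 𝒜] {X Y Z Z' : 𝒜}

/-- The bundled form of a 2-cell. -/
abbrev of {f g : X ⟶ Y} (η : f ⟶ g) : TwoCell X Y := ⟨f, g, η⟩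

/-- The identity 2-cell of `f`. -/
abbrev idCell (f : X ⟶ Y) : TwoCell X Y := of (𝟙 f)

theorem of_comp_eqToHom {f g h : X ⟶ Y} (η : f ⟶ g) (e : g = h) : of (η ≫ eqToHom e) = of η := by
  subst e; simp

theorem of_eqToHom_comp {f g h : X ⟶ Y} (η : g ⟶ h) (e : f = g) : of (eqToHom e ≫ η) = of η := by
  subst e; simp

theorem of_injective {f g : X ⟶ Y} {η θ : f ⟶ g} (h : of η = of θ) : η = θ := by
  injection h

/-- Bundling turns equality up to `eqToHom` into a genuine equality, which can be rewritten and
chained. -/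
theorem eqTwoCell_iff {f g f' g' : X ⟶ Y} {η : f ⟶ g} {θ : f' ⟶ g'} :
    EqTwoCell η θ ↔ of η = of θ := by
  constructor
  · rintro ⟨h, k, e⟩
    rw [e, of_eqToHom_comp, of_comp_eqToHom]
  · intro e
    injection e with h k e
    subst h k
    obtain rfl := eq_of_heq e
    exact ⟨rfl, rfl, by simp⟩

theorem isIdTwoCell_iff {f g : X ⟶ Y} {η : f ⟶ g} : IsIdTwoCell η ↔ of η = idCell f := by
  constructor
  · rintro ⟨rfl, rfl⟩
    rfl
  · intro e
    injection e with h k e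
    subst k
    obtain rfl := eq_of_heq e
    exact ⟨rfl, rfl⟩

theorem isIdTwoCell_of_eq {f g h : X ⟶ Y} {η : f ⟶ g} (e : of η = idCell h) : IsIdTwoCell η := by
  obtain rfl : f = h := congrArg src e
  exact isIdTwoCell_iff.2 e

/-- The underlying 2-cell, transported to equal source and target. -/
def cast (c : TwoCell X Y) {f g : X ⟶ Y} (h : c.src = f) (k : c.tgt = g) : f ⟶ g :=
  eqToHom h.symm ≫ c.hom ≫ eqToHom k

@[simp]
theorem of_cast (c : TwoCell X Y) {f g : X ⟶ Y} (h : c.src = f) (k : c.tgt = g) :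
    of (c.cast h k) = c := by
  rw [cast, of_eqToHom_comp, of_comp_eqToHom]

/-- Vertical composition. -/
def vcomp (c d : TwoCell X Y) (h : c.tgt = d.src) : TwoCell X Y := of (c.hom ≫ eqToHom h ≫ d.hom)

theorem vcomp_congr {c c' d d' : TwoCell X Y} (hc : c = c') (hd : d = d') (h : c.tgt = d.src)
    (h' : c'.tgt = d'.src) : vcomp c d h = vcomp c' d' h' := by
  subst hc hd; rfl

theorem exists_vcomp_eq_vcomp {c d c' d' k l k' l' : TwoCell X Y} (hc : c = c') (hd : d = d')
    (hk : k = k') (hl : l = l') {h : c.tgt = d.src} {h' : k.tgt = l.src}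
    (e : vcomp c d h = vcomp k l h') : ∃ h h', vcomp c' d' h = vcomp k' l' h' := by
  subst hc hd hk hl
  exact ⟨h, h', e⟩

theorem of_comp {f g h : X ⟶ Y} (η : f ⟶ g) (θ : g ⟶ h) :
    of (η ≫ θ) = vcomp (of η) (of θ) rfl := by
  simp [vcomp]

theorem of_comp_eqToHom_comp {f g g' h : X ⟶ Y} (η : f ⟶ g) (e : g = g') (θ : g' ⟶ h) :
    of (η ≫ eqToHom e ≫ θ) = vcomp (of η) (of θ) e := rfl

theorem vcomp_idCell (c : TwoCell X Y) (f : X ⟶ Y) (h : c.tgt = f) :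
    vcomp c (idCell f) h = c := by
  subst h; simp [vcomp]

theorem idCell_vcomp (c : TwoCell X Y) (f : X ⟶ Y) (h : f = c.src) :
    vcomp (idCell f) c h = c := by
  subst h; simp [vcomp]

theorem isIdTwoCell_cast {c : TwoCell X Y} {k : X ⟶ Y} (e : c = idCell k) {f g : X ⟶ Y}
    (hf : c.src = f) (hg : c.tgt = g) : IsIdTwoCell (c.cast hf hg) :=
  isIdTwoCell_of_eq ((of_cast c hf hg).trans e)

/-- Left whiskering. -/
def wl (f : X ⟶ Y) (c : TwoCell Y Z) : TwoCell X Z := of (f ◁ c.hom)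

/-- Right whiskering. -/
def wr (c : TwoCell X Y) (f : Y ⟶ Z) : TwoCell X Z := of (c.hom ▷ f)

@[simp] theorem wl_src (f : X ⟶ Y) (c : TwoCell Y Z) : (wl f c).src = f ≫ c.src := rfl
@[simp] theorem wl_tgt (f : X ⟶ Y) (c : TwoCell Y Z) : (wl f c).tgt = f ≫ c.tgt := rfl
@[simp] theorem wr_src (c : TwoCell X Y) (f : Y ⟶ Z) : (wr c f).src = c.src ≫ f := rfl
@[simp] theorem wr_tgt (c : TwoCell X Y) (f : Y ⟶ Z) : (wr c f).tgt = c.tgt ≫ f := rfl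

theorem wl_of (f : X ⟶ Y) {g h : Y ⟶ Z} (η : g ⟶ h) : wl f (of η) = of (f ◁ η) := rfl

theorem of_wr {f g : X ⟶ Y} (η : f ⟶ g) (h : Y ⟶ Z) : wr (of η) h = of (η ▷ h) := rfl

@[simp]
theorem wl_idCell (f : X ⟶ Y) (g : Y ⟶ Z) : wl f (idCell g) = idCell (f ≫ g) := by simp [wl]

@[simp]
theorem idCell_wr (f : X ⟶ Y) (g : Y ⟶ Z) : wr (idCell f) g = idCell (f ≫ g) := by simp [wr]

theorem vcomp_wr (c d : TwoCell X Y) (h : c.tgt = d.src) (f : Y ⟶ Z) :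
    wr (vcomp c d h) f = vcomp (wr c f) (wr d f) (congrArg (· ≫ f) h) := by
  obtain ⟨_, _, c⟩ := c
  obtain ⟨_, _, d⟩ := d
  dsimp at h
  subst h
  simp [vcomp, wr]

theorem of_whiskerRight_comp {f f' : X ⟶ Y} (η : f ⟶ f') (g : Y ⟶ Z) {h : X ⟶ Z}
    (θ : f' ≫ g ⟶ h) : of (η ▷ g ≫ θ) = vcomp (wr (of η) g) (of θ) rfl :=
  of_comp _ _

theorem of_whiskerLeft_comp (f : X ⟶ Y) {g g' : Y ⟶ Z} (η : g ⟶ g') {h : X ⟶ Z}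
    (θ : f ≫ g' ⟶ h) : of (f ◁ η ≫ θ) = vcomp (wl f (of η)) (of θ) rfl :=
  of_comp _ _

end Basic

section Strict

variable {𝒜 : Type u} [Bicategory.{w, v} 𝒜] [Bicategory.Strict 𝒜] {X Y Z Z' : 𝒜}

@[simp]
-- In a strict bicategory the associators are `eqToHom`s, which bundling erases.
theorem wl_wl (f : X ⟶ Y) (g : Y ⟶ Z) (c : TwoCell Z Z') : wl f (wl g c) = wl (f ≫ g) c := by
  simp only [wl]
  rw [Bicategory.comp_whiskerLeft]
  simp only [Bicategory.Strict.associator_eqToIso, eqToIso.hom, eqToIso.inv, of_eqToHom_comp,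
    of_comp_eqToHom]

@[simp]
theorem wr_wr (c : TwoCell X Y) (f : Y ⟶ Z) (g : Z ⟶ Z') : wr (wr c f) g = wr c (f ≫ g) := by
  simp only [wr]
  rw [Bicategory.whiskerRight_comp]
  simp only [Bicategory.Strict.associator_eqToIso, eqToIso.hom, eqToIso.inv, of_eqToHom_comp,
    of_comp_eqToHom]

theorem wr_wl (f : X ⟶ Y) (c : TwoCell Y Z) (g : Z ⟶ Z') : wr (wl f c) g = wl f (wr c g) := by
  simp only [wr, wl]
  rw [Bicategory.whisker_assoc]
  simp only [Bicategory.Strict.associator_eqToIso, eqToIso.hom, eqToIso.inv, of_eqToHom_comp,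
    of_comp_eqToHom]

@[simp]
theorem wl_id (c : TwoCell X Y) : wl (𝟙 X) c = c := by
  simp only [wl]
  rw [Bicategory.id_whiskerLeft]
  simp only [Bicategory.Strict.leftUnitor_eqToIso, eqToIso.hom, eqToIso.inv, of_eqToHom_comp,
    of_comp_eqToHom]

@[simp]
theorem wr_id (c : TwoCell X Y) : wr c (𝟙 Y) = c := by
  simp only [wr]
  rw [Bicategory.whiskerRight_id]
  simp only [Bicategory.Strict.rightUnitor_eqToIso, eqToIso.hom, eqToIso.inv, of_eqToHom_comp,
    of_comp_eqToHom]

theorem wl_cancel {f : X ⟶ Y} {f' : Y ⟶ X} (h : f' ≫ f = 𝟙 _) {c d : TwoCell Y Z}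
    (e : wl f c = wl f d) : c = d := by
  have := congrArg (wl f') e
  rwa [wl_wl, wl_wl, h, wl_id, wl_id] at this

theorem wr_cancel {f : Y ⟶ Z} {f' : Z ⟶ Y} (h : f ≫ f' = 𝟙 _) {c d : TwoCell X Y}
    (e : wr c f = wr d f) : c = d := by
  have := congrArg (wr · f') e
  rwa [wr_wr, wr_wr, h, wr_id, wr_id] at this

end Strict

section Action

variable {W : Type u₁} [Category.{v₁} W] [MonoidalCategory W]
  {𝒜 : Type u} [Bicategory.{w, v} 𝒜] [Bicategory.Strict 𝒜] [TwoAction W 𝒜] {X Y Z : 𝒜}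

/-- The value of the 2-functor `- ⋆ V` at a bundled 2-cell. -/
def act (c : TwoCell X Y) (V : W) : TwoCell (X ⊙ᵣ V) (Y ⊙ᵣ V) := of (TwoAction.actionTwo c.hom V)

@[simp] theorem act_src (c : TwoCell X Y) (V : W) : (act c V).src = c.src ⊵ᵣ V := rfl
@[simp] theorem act_tgt (c : TwoCell X Y) (V : W) : (act c V).tgt = c.tgt ⊵ᵣ V := rfl

theorem act_of {f g : X ⟶ Y} (η : f ⟶ g) (V : W) :
    act (of η) V = of (TwoAction.actionTwo η V) := rfl

theorem act_idCell (f : X ⟶ Y) (V : W) : act (idCell f) V = idCell (f ⊵ᵣ V) := by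
  simp only [act, TwoAction.actionTwo_id]

theorem act_wl (f : X ⟶ Y) (c : TwoCell Y Z) (V : W) : act (wl f c) V = wl (f ⊵ᵣ V) (act c V) :=
  eqTwoCell_iff.1 (TwoAction.actionTwo_whiskerLeft f c.hom V)

theorem act_wr (c : TwoCell X Y) (f : Y ⟶ Z) (V : W) : act (wr c f) V = wr (act c V) (f ⊵ᵣ V) :=
  eqTwoCell_iff.1 (TwoAction.actionTwo_whiskerRight c.hom f V)

theorem act_vcomp (c d : TwoCell X Y) (h : c.tgt = d.src) (V : W) :
    act (vcomp c d h) V = vcomp (act c V) (act d V) (congrArg (· ⊵ᵣ V) h) := by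
  obtain ⟨_, _, c⟩ := c
  obtain ⟨_, _, d⟩ := d
  dsimp at h
  subst h
  simp [vcomp, act, TwoAction.actionTwo_comp]

theorem act_vcomp_wr (c d : TwoCell X Y) (h : c.tgt = d.src) (V : W) (f : Y ⊙ᵣ V ⟶ Z) :
    wr (act (vcomp c d h) V) f =
      vcomp (wr (act c V) f) (wr (act d V) f) (congrArg (fun g => g ⊵ᵣ V ≫ f) h) :=
  (congrArg (wr · f) (act_vcomp c d h V)).trans (vcomp_wr _ _ _ f)

theorem eqTwoCell_cast_act {X' Y' : 𝒜} {c : TwoCell X' Y'} {d : TwoCell X Y} {V : W}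
    {f : X ⊙ᵣ V ⟶ X'} {g : Y ⊙ᵣ V ⟶ Y'} (e : wl f c = wr (act d V) g)
    {c₁ c₂ : X' ⟶ Y'} (hc₁ : c.src = c₁) (hc₂ : c.tgt = c₂)
    {d₁ d₂ : X ⟶ Y} (hd₁ : d.src = d₁) (hd₂ : d.tgt = d₂) :
    EqTwoCell (f ◁ c.cast hc₁ hc₂) (TwoAction.actionTwo (d.cast hd₁ hd₂) V ▷ g) := by
  rw [eqTwoCell_iff, ← wl_of, ← of_wr, ← act_of, of_cast, of_cast, e]

theorem wl_actionHomRight (c : TwoCell X Y) {V V' : W} (p : V ⟶ V') :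
    wl (X ⊴ᵣ p) (act c V') = wr (act c V) (Y ⊴ᵣ p) :=
  (eqTwoCell_iff.1 (TwoAction.actionTwo_naturality c.hom p)).symm

theorem act_tensor (c : TwoCell X Y) (V V' : W) :
    wr (act c (V ⊗ V')) (αᵣ Y V V').hom = wl (αᵣ X V V').hom (act (act c V) V') :=
  eqTwoCell_iff.1 (TwoAction.actionTwo_assoc c.hom V V')

theorem act_unit (c : TwoCell X Y) :
    wr (act c (𝟙_ W)) (ρᵣ[W] Y).hom = wl (ρᵣ[W] X).hom c :=
  eqTwoCell_iff.1 (TwoAction.actionTwo_unit c.hom)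

theorem act_act (c : TwoCell X Y) (V V' : W) :
    wr (act (act c V) V') (αᵣ Y V V').inv = wl (αᵣ X V V').inv (act c (V ⊗ V')) := by
  refine wr_cancel (αᵣ Y V V').hom_inv_id ?_
  rw [wr_wr, Iso.inv_hom_id, wr_id, wr_wl, act_tensor, wl_wl, Iso.inv_hom_id, wl_id]

/-- By 2-naturality of the unit constraint, `- ⋆ I` is conjugate to the identity, hence faithful on
2-cells. -/
theorem act_unit_cancel {c d : TwoCell X Y} (h : act c (𝟙_ W) = act d (𝟙_ W)) : c = d :=
  wl_cancel (ρᵣ[W] X).inv_hom_id (by rw [← act_unit, ← act_unit, h])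

end Action

end TwoCell

/-! ### The data `γ` and `τ` acted on by an object `V`. -/

section ActedCoalgebra

variable {W : Type u₁} [Category.{v₁} W] [MonoidalCategory W]
  {𝒜 : Type u} [Bicategory.{w, v} 𝒜] [Bicategory.Strict 𝒜] [TwoAction W 𝒜]
  (B : W) {A : 𝒜}

/-- The 1-cell `γ ⋆ V`, as a 1-cell into `A ⋆ (B ⊗ V)`. -/
def gammaAct (γ : A ⟶ A ⊙ᵣ B) (V : W) : A ⊙ᵣ V ⟶ A ⊙ᵣ (B ⊗ V) :=
  γ ⊵ᵣ V ≫ (αᵣ A B V).inv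

/-- The canonical isomorphism `((X ⋆ B) ⋆ B) ⋆ V ≅ X ⋆ (B ⊗ B ⊗ V)`. -/
def assocTwo (X : 𝒜) (V : W) : ((X ⊙ᵣ B) ⊙ᵣ B) ⊙ᵣ V ≅ X ⊙ᵣ (B ⊗ B ⊗ V) :=
  (αᵣ (X ⊙ᵣ B) B V).symm ≪≫ (αᵣ X B (B ⊗ V)).symm

theorem assocTwo_hom (X : 𝒜) (V : W) :
    (assocTwo B X V).hom = (αᵣ (X ⊙ᵣ B) B V).inv ≫ (αᵣ X B (B ⊗ V)).inv := rfl

/-- The 2-cell `c ⋆ V`, as a 2-cell into `A ⋆ (B ⊗ B ⊗ V)`. -/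
def cellAct (c : TwoCell A ((A ⊙ᵣ B) ⊙ᵣ B)) (V : W) : TwoCell (A ⊙ᵣ V) (A ⊙ᵣ (B ⊗ B ⊗ V)) :=
  (c.act V).wr (assocTwo B A V).hom

theorem assocInv_naturality_right (X : 𝒜) {V V' : W} (p : V ⟶ V') :
    (X ⊙ᵣ B) ⊴ᵣ p ≫ (αᵣ X B V').inv = (αᵣ X B V).inv ≫ X ⊴ᵣ (B ◁ p) := by
  simp

theorem assocInv_naturality_left {X Y : 𝒜} (f : X ⟶ Y) (V V' : W) :
    (f ⊵ᵣ V) ⊵ᵣ V' ≫ (αᵣ Y V V').inv = (αᵣ X V V').inv ≫ f ⊵ᵣ (V ⊗ V') := by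
  simp

theorem assocInv_pentagon (X : 𝒜) (U V V' : W) :
    (αᵣ X U V).inv ⊵ᵣ V' ≫ (αᵣ X (U ⊗ V) V').inv ≫ X ⊴ᵣ (α_ U V V').hom =
      (αᵣ (X ⊙ᵣ U) V V').inv ≫ (αᵣ X U (V ⊗ V')).inv := by
  have h := MonoidalRightAction.actionHom_associator U V V' X
  rw [← cancel_mono (αᵣ X U (V ⊗ V')).hom, ← cancel_mono (αᵣ (X ⊙ᵣ U) V V').hom]
  simp only [Category.assoc]
  rw [h]
  simp

theorem assocTwo_comp_assocInv (X : 𝒜) (V : W) :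
    (assocTwo B (X ⊙ᵣ B) V).hom ≫ (αᵣ X B (B ⊗ B ⊗ V)).inv =
      (αᵣ ((X ⊙ᵣ B) ⊙ᵣ B) B V).inv ≫ (assocTwo B X (B ⊗ V)).hom :=
  Category.assoc _ _ _

/-- The 1-cells `gammaAct B γ V` are natural in `V`; this lets morphisms of `W` slide past `γ`. -/
theorem actionHomRight_comp_gammaAct (γ : A ⟶ A ⊙ᵣ B) {V V' : W} (p : V ⟶ V') :
    A ⊴ᵣ p ≫ gammaAct B γ V' = gammaAct B γ V ≫ A ⊴ᵣ (B ◁ p) := by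
  rw [gammaAct, gammaAct, ← Category.assoc, MonoidalRightAction.action_exchange, Category.assoc,
    Category.assoc, assocInv_naturality_right]

theorem actionHomRight_comp_assocTwo (X : 𝒜) {V V' : W} (p : V ⟶ V') :
    ((X ⊙ᵣ B) ⊙ᵣ B) ⊴ᵣ p ≫ (assocTwo B X V').hom = (assocTwo B X V).hom ≫ X ⊴ᵣ (B ◁ B ◁ p) := by
  rw [assocTwo_hom, assocTwo_hom, ← Category.assoc, assocInv_naturality_right, Category.assoc,
    assocInv_naturality_right, Category.assoc]

theorem wl_cellAct (c : TwoCell A ((A ⊙ᵣ B) ⊙ᵣ B)) {V V' : W} (p : V ⟶ V') :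
    (cellAct B c V').wl (A ⊴ᵣ p) = (cellAct B c V).wr (A ⊴ᵣ (B ◁ B ◁ p)) := by
  rw [cellAct, cellAct, ← TwoCell.wr_wl, TwoCell.wl_actionHomRight, TwoCell.wr_wr, TwoCell.wr_wr,
    actionHomRight_comp_assocTwo]

theorem gammaAct_comp_gammaAct (γ : A ⟶ A ⊙ᵣ B) (V : W) :
    gammaAct B γ V ≫ gammaAct B γ (B ⊗ V) = (γ ≫ γ ⊵ᵣ B) ⊵ᵣ V ≫ (assocTwo B A V).hom := by
  simp [gammaAct, assocTwo]

/-- One of four lemmas, with `cellAct_wr_gammaAct`, `cellAct_wr_headComul` and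
`cellAct_wr_whiskerLeft_headComul`. They identify the four 2-cells of `CellCocycle` with those of
the cocycle condition on `c`, acted on by `V` and followed by one and the same invertible 1-cell. -/
theorem gammaAct_wl_cellAct (γ : A ⟶ A ⊙ᵣ B) (c : TwoCell A ((A ⊙ᵣ B) ⊙ᵣ B)) (V : W) :
    (cellAct B c (B ⊗ V)).wl (gammaAct B γ V) =
      (((c.act B).wl γ).act V).wr
        ((assocTwo B (A ⊙ᵣ B) V).hom ≫ (αᵣ A B (B ⊗ B ⊗ V)).inv) := by
  rw [assocTwo_comp_assocInv, ← TwoCell.wr_wr, TwoCell.act_wl, TwoCell.wr_wl, TwoCell.act_act,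
    TwoCell.wl_wl, TwoCell.wr_wl]
  rfl

theorem cellAct_wr_gammaAct (γ : A ⟶ A ⊙ᵣ B) (c : TwoCell A ((A ⊙ᵣ B) ⊙ᵣ B)) (V : W) :
    (cellAct B c V).wr (gammaAct B γ (B ⊗ B ⊗ V)) =
      ((c.wr ((γ ⊵ᵣ B) ⊵ᵣ B)).act V).wr
        ((assocTwo B (A ⊙ᵣ B) V).hom ≫ (αᵣ A B (B ⊗ B ⊗ V)).inv) := by
  rw [cellAct, TwoCell.wr_wr, TwoCell.act_wr, TwoCell.wr_wr]
  congr 1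
  simp [gammaAct, assocTwo]

/-- Every 2-cell of this type is `cellAct` of something at the unit object. This is how `τ` is
recovered from a constraint. -/
theorem cellAct_conj_unit (d : TwoCell (A ⊙ᵣ 𝟙_ W) (A ⊙ᵣ (B ⊗ B ⊗ 𝟙_ W))) :
    cellAct B (TwoCell.wl (ρᵣ[W] A).inv (TwoCell.wr d
      ((assocTwo B A (𝟙_ W)).inv ≫ (ρᵣ[W] ((A ⊙ᵣ B) ⊙ᵣ B)).hom))) (𝟙_ W) = d := by
  refine TwoCell.wr_cancel (assocTwo B A (𝟙_ W)).inv_hom_id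
    (TwoCell.wr_cancel (ρᵣ[W] ((A ⊙ᵣ B) ⊙ᵣ B)).hom_inv_id ?_)
  rw [cellAct, TwoCell.wr_wr _ (assocTwo B A (𝟙_ W)).hom, Iso.hom_inv_id, TwoCell.wr_id,
    TwoCell.act_unit, TwoCell.wl_wl, Iso.hom_inv_id, TwoCell.wl_id, TwoCell.wr_wr]

theorem conj_act_unit (f : A ⟶ (A ⊙ᵣ B) ⊙ᵣ B) :
    (ρᵣ[W] A).inv ≫ (f ⊵ᵣ (𝟙_ W) ≫ (assocTwo B A (𝟙_ W)).hom) ≫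
      (assocTwo B A (𝟙_ W)).inv ≫ (ρᵣ[W] ((A ⊙ᵣ B) ⊙ᵣ B)).hom = f := by
  simp

theorem actionHomRight_inv_comp_assoc (X : 𝒜) {V U V' : W} (a : V ⊗ U ≅ V') :
    (X ⊴ᵣ a.inv ≫ (αᵣ X V U).hom) ≫ (αᵣ X V U).inv ≫ X ⊴ᵣ a.hom = 𝟙 _ := by
  simp

section

variable [ComonObj B]

theorem comonadComul_comp_assocTwo (X : 𝒜) (V : W) :
    comonadComul B X ⊵ᵣ V ≫ (assocTwo B X V).hom = (αᵣ X B V).inv ≫ X ⊴ᵣ headComul B V := by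
  have h := MonoidalRightAction.actionHom_associator B B V X
  rw [assocTwo_hom, ← Category.assoc, Iso.comp_inv_eq, Iso.comp_inv_eq, headComul, comonadComul]
  simp

theorem comonadCounit_act (X : 𝒜) (V : W) :
    comonadCounit B X ⊵ᵣ V = (αᵣ X B V).inv ≫ X ⊴ᵣ headCounit B V := by
  simp [comonadCounit, headCounit]

theorem gammaAct_comp_headComul (γ : A ⟶ A ⊙ᵣ B) (V : W) :
    gammaAct B γ V ≫ A ⊴ᵣ headComul B V =
      (γ ≫ comonadComul B A) ⊵ᵣ V ≫ (assocTwo B A V).hom := by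
  rw [MonoidalRightAction.comp_actionHomLeft, Category.assoc, comonadComul_comp_assocTwo, gammaAct,
    Category.assoc]

theorem gammaAct_comp_headCounit (γ : A ⟶ A ⊙ᵣ B) (V : W) :
    gammaAct B γ V ≫ A ⊴ᵣ headCounit B V = (γ ≫ comonadCounit B A) ⊵ᵣ V := by
  rw [MonoidalRightAction.comp_actionHomLeft, comonadCounit_act, gammaAct, Category.assoc]

/-- The leftmost tensor factor is the one that acts first, so the counit at the head of `B ⊗ B ⊗ V`
is the inner one, `comonadCounit B X ⊵ᵣ B`. -/
theorem assocTwo_comp_headCounit (X : 𝒜) (V : W) :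
    (assocTwo B X V).hom ≫ X ⊴ᵣ headCounit B (B ⊗ V) =
      (comonadCounit B X ⊵ᵣ B) ⊵ᵣ V ≫ (αᵣ X B V).inv := by
  rw [assocInv_naturality_left, comonadCounit_act, assocTwo_hom, Category.assoc]

theorem assocTwo_comp_whiskerLeft_headCounit (X : 𝒜) (V : W) :
    (assocTwo B X V).hom ≫ X ⊴ᵣ (B ◁ headCounit B V) =
      comonadCounit B (X ⊙ᵣ B) ⊵ᵣ V ≫ (αᵣ X B V).inv := by
  rw [comonadCounit_act, assocTwo_hom, Category.assoc, Category.assoc, assocInv_naturality_right]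

theorem cellAct_wr_headCounit (c : TwoCell A ((A ⊙ᵣ B) ⊙ᵣ B)) (V : W) :
    (cellAct B c V).wr (A ⊴ᵣ headCounit B (B ⊗ V)) =
      ((c.wr (comonadCounit B A ⊵ᵣ B)).act V).wr (αᵣ A B V).inv := by
  rw [cellAct, TwoCell.wr_wr, assocTwo_comp_headCounit, TwoCell.act_wr, TwoCell.wr_wr]

theorem cellAct_wr_whiskerLeft_headCounit (c : TwoCell A ((A ⊙ᵣ B) ⊙ᵣ B)) (V : W) :
    (cellAct B c V).wr (A ⊴ᵣ (B ◁ headCounit B V)) =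
      ((c.wr (comonadCounit B (A ⊙ᵣ B))).act V).wr (αᵣ A B V).inv := by
  rw [cellAct, TwoCell.wr_wr, assocTwo_comp_whiskerLeft_headCounit, TwoCell.act_wr, TwoCell.wr_wr]

theorem cellAct_wr_headComul (c : TwoCell A ((A ⊙ᵣ B) ⊙ᵣ B)) (V : W) :
    (cellAct B c V).wr (A ⊴ᵣ headComul B (B ⊗ V)) =
      ((c.wr (comonadComul B A ⊵ᵣ B)).act V).wr
        ((assocTwo B (A ⊙ᵣ B) V).hom ≫ (αᵣ A B (B ⊗ B ⊗ V)).inv) := by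
  rw [cellAct, TwoCell.wr_wr, TwoCell.act_wr, TwoCell.wr_wr]
  congr 1
  rw [assocTwo_comp_assocInv, ← Category.assoc, assocInv_naturality_left, Category.assoc,
    comonadComul_comp_assocTwo, assocTwo_hom, Category.assoc]

theorem cellAct_wr_whiskerLeft_headComul (c : TwoCell A ((A ⊙ᵣ B) ⊙ᵣ B)) (V : W) :
    (cellAct B c V).wr (A ⊴ᵣ (B ◁ headComul B V)) =
      ((c.wr (comonadComul B (A ⊙ᵣ B))).act V).wr
        ((assocTwo B (A ⊙ᵣ B) V).hom ≫ (αᵣ A B (B ⊗ B ⊗ V)).inv) := by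
  rw [cellAct, TwoCell.wr_wr, TwoCell.act_wr, TwoCell.wr_wr]
  congr 1
  rw [← Category.assoc, comonadComul_comp_assocTwo, assocTwo_hom, Category.assoc, Category.assoc,
    assocInv_naturality_right]

end

theorem gammaAct_act (γ : A ⟶ A ⊙ᵣ B) (V U : W) :
    gammaAct B γ V ⊵ᵣ U ≫ (αᵣ A (B ⊗ V) U).inv ≫ A ⊴ᵣ (α_ B V U).hom =
      (αᵣ A V U).inv ≫ gammaAct B γ (V ⊗ U) := by
  rw [gammaAct, MonoidalRightAction.comp_actionHomLeft, Category.assoc, assocInv_pentagon,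
    gammaAct, ← Category.assoc, assocInv_naturality_left, Category.assoc]

theorem cellAct_act (c : TwoCell A ((A ⊙ᵣ B) ⊙ᵣ B)) (V U : W) :
    ((cellAct B c V).act U).wr ((αᵣ A (B ⊗ B ⊗ V) U).inv ≫
        A ⊴ᵣ ((α_ B (B ⊗ V) U).hom ≫ B ◁ (α_ B V U).hom)) =
      (cellAct B c (V ⊗ U)).wl (αᵣ A V U).inv := by
  have h : (assocTwo B A V).hom ⊵ᵣ U ≫ (αᵣ A (B ⊗ B ⊗ V) U).inv ≫
      A ⊴ᵣ ((α_ B (B ⊗ V) U).hom ≫ B ◁ (α_ B V U).hom) =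
      (αᵣ ((A ⊙ᵣ B) ⊙ᵣ B) V U).inv ≫ (assocTwo B A (V ⊗ U)).hom := by
    have h₁ := assocInv_pentagon A B (B ⊗ V) U
    have h₂ := assocInv_pentagon (A ⊙ᵣ B) B V U
    have h₃ := assocInv_naturality_right B A (α_ B V U).hom
    rw [assocTwo_hom, assocTwo_hom, MonoidalRightAction.comp_actionHomLeft,
      MonoidalRightAction.actionHomRight_comp, Category.assoc, reassoc_of% h₁, ← h₃,
      reassoc_of% h₂]
  rw [cellAct, cellAct, TwoCell.act_wr, TwoCell.wr_wr, h, ← TwoCell.wr_wr, TwoCell.act_act,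
    TwoCell.wr_wl]

end ActedCoalgebra

/-! ### 1-cells and constraints induced by coKleisli morphisms of `B ⊗ -`. -/

section Kleisli

variable {W : Type u₁} [Category.{v₁} W] [MonoidalCategory W]
  {𝒜 : Type u} [Bicategory.{w, v} 𝒜] [Bicategory.Strict 𝒜] [TwoAction W 𝒜]
  (B : W) {A : 𝒜} (γ : A ⟶ A ⊙ᵣ B)

/-- The 1-cell `A ⋆ V ⟶ A ⋆ V'` induced by `γ` and a coKleisli morphism. -/
def kleisliMap {V V' : W} (φ : B ⊗ V ⟶ V') : A ⊙ᵣ V ⟶ A ⊙ᵣ V' := gammaAct B γ V ≫ A ⊴ᵣ φ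

/-- The 2-cell from the composite of the 1-cells induced by `φ` and `ψ` to the 1-cell induced by
their coKleisli composite. -/
def kleisliCell (c : TwoCell A ((A ⊙ᵣ B) ⊙ᵣ B)) {V V' V'' : W} (φ : B ⊗ V ⟶ V')
    (ψ : B ⊗ V' ⟶ V'') : TwoCell (A ⊙ᵣ V) (A ⊙ᵣ V'') :=
  (cellAct B c V).wr (A ⊴ᵣ (B ◁ φ ≫ ψ))

variable {V V' V'' V''' : W} (φ : B ⊗ V ⟶ V') (ψ : B ⊗ V' ⟶ V'') (χ : B ⊗ V'' ⟶ V''')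

theorem kleisliMap_comp : kleisliMap B γ φ ≫ kleisliMap B γ ψ =
    gammaAct B γ V ≫ gammaAct B γ (B ⊗ V) ≫ A ⊴ᵣ (B ◁ φ ≫ ψ) := by
  have h := actionHomRight_comp_gammaAct B γ φ
  simp only [kleisliMap, Category.assoc, MonoidalRightAction.actionHomRight_comp]
  rw [reassoc_of% h]

theorem kleisliMap_id (V : W) : kleisliMap B γ (𝟙 (B ⊗ V)) = gammaAct B γ V := by
  simp [kleisliMap]

theorem actionHomRight_act_comp_assocInv (X : 𝒜) {V V' : W} (p : V ⟶ V') (U : W) :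
    (X ⊴ᵣ p) ⊵ᵣ U ≫ (αᵣ X V' U).inv = (αᵣ X V U).inv ≫ X ⊴ᵣ (p ▷ U) := by
  simp

theorem kleisliCell_id_left (c : TwoCell A ((A ⊙ᵣ B) ⊙ᵣ B)) (ψ : B ⊗ B ⊗ V ⟶ V'') :
    kleisliCell B c (𝟙 (B ⊗ V)) ψ = (cellAct B c V).wr (A ⊴ᵣ ψ) := by
  simp [kleisliCell]

theorem kleisliCell_id_right (c : TwoCell A ((A ⊙ᵣ B) ⊙ᵣ B)) :
    kleisliCell B c φ (𝟙 (B ⊗ V')) = (cellAct B c V).wr (A ⊴ᵣ (B ◁ φ)) := by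
  rw [kleisliCell, Category.comp_id]

theorem kleisliCell_id_id (c : TwoCell A ((A ⊙ᵣ B) ⊙ᵣ B)) (V : W) :
    kleisliCell B c (𝟙 (B ⊗ V)) (𝟙 (B ⊗ B ⊗ V)) = cellAct B c V := by
  simp [kleisliCell]

theorem kleisliMap_act {U : W} {X X' : W} (a : V ⊗ U ⟶ X) (a' : V' ⊗ U ⟶ X') (φ' : B ⊗ X ⟶ X')
    (h : ((α_ B V U).hom ≫ B ◁ a) ≫ φ' = φ ▷ U ≫ a') :
    ((αᵣ A V U).inv ≫ A ⊴ᵣ a) ≫ kleisliMap B γ φ' =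
      kleisliMap B γ φ ⊵ᵣ U ≫ (αᵣ A V' U).inv ≫ A ⊴ᵣ a' := by
  have h₁ := actionHomRight_comp_gammaAct B γ a
  have h₂ := gammaAct_act B γ V U
  have h₃ := congrArg (A ⊴ᵣ ·) h
  have h₄ := actionHomRight_act_comp_assocInv A φ U
  simp only [MonoidalRightAction.actionHomRight_comp, Category.assoc] at h₃
  simp only [kleisliMap, Category.assoc, MonoidalRightAction.comp_actionHomLeft]
  rw [reassoc_of% h₁, ← reassoc_of% h₂, reassoc_of% h₄, h₃]

/-- The squares `h` and `h'` paste to one for `B ◁ φ ≫ ψ`; the rest is `cellAct_act` and naturality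
of `cellAct` in `V`. -/
theorem kleisliCell_act (c : TwoCell A ((A ⊙ᵣ B) ⊙ᵣ B)) {U : W} {X X' X'' : W}
    (a : V ⊗ U ⟶ X) (a' : V' ⊗ U ⟶ X') (a'' : V'' ⊗ U ⟶ X'')
    (φ' : B ⊗ X ⟶ X') (ψ' : B ⊗ X' ⟶ X'')
    (h : ((α_ B V U).hom ≫ B ◁ a) ≫ φ' = φ ▷ U ≫ a')
    (h' : ((α_ B V' U).hom ≫ B ◁ a') ≫ ψ' = ψ ▷ U ≫ a'') :
    (kleisliCell B c φ' ψ').wl ((αᵣ A V U).inv ≫ A ⊴ᵣ a) =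
      ((kleisliCell B c φ ψ).act U).wr ((αᵣ A V'' U).inv ≫ A ⊴ᵣ a'') := by
  have h₁ : ((B ◁ φ ≫ ψ) ▷ U) ≫ a'' =
      ((α_ B (B ⊗ V) U).hom ≫ B ◁ (α_ B V U).hom) ≫ B ◁ B ◁ a ≫ B ◁ φ' ≫ ψ' := by
    have e := congrArg (B ◁ ·) h
    simp only [MonoidalCategory.whiskerLeft_comp, Category.assoc] at e h' ⊢
    rw [reassoc_of% e, MonoidalCategory.comp_whiskerRight, Category.assoc, ← h']
    simp
  have h₂ := actionHomRight_act_comp_assocInv A (B ◁ φ ≫ ψ) U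
  rw [kleisliCell, kleisliCell, TwoCell.act_wr, TwoCell.wr_wr, reassoc_of% h₂,
    ← MonoidalRightAction.actionHomRight_comp, h₁]
  generalize B ◁ φ' ≫ ψ' = ω
  rw [MonoidalRightAction.actionHomRight_comp A (_ ≫ B ◁ (α_ B V U).hom), ← Category.assoc,
    ← TwoCell.wr_wr, cellAct_act, ← TwoCell.wl_wl, ← TwoCell.wr_wl (A ⊴ᵣ a),
    wl_cellAct, TwoCell.wr_wr, TwoCell.wr_wl, ← MonoidalRightAction.actionHomRight_comp]

theorem cellAct_act_comp (c : TwoCell A ((A ⊙ᵣ B) ⊙ᵣ B)) {U X : W} (a : V ⊗ U ⟶ X) :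
    (cellAct B c X).wl ((αᵣ A V U).inv ≫ A ⊴ᵣ a) =
      ((cellAct B c V).act U).wr ((αᵣ A (B ⊗ B ⊗ V) U).inv ≫
        A ⊴ᵣ ((α_ B (B ⊗ V) U).hom ≫ B ◁ ((α_ B V U).hom ≫ B ◁ a))) := by
  rw [← kleisliCell_id_id, ← kleisliCell_id_id]
  exact kleisliCell_act B _ _ c a ((α_ B V U).hom ≫ B ◁ a) _ _ _ (by simp) (by simp)

section

variable {γ} {c : TwoCell A ((A ⊙ᵣ B) ⊙ᵣ B)}

theorem cellAct_src (hs : c.src = γ ≫ γ ⊵ᵣ B) (V : W) :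
    (cellAct B c V).src = gammaAct B γ V ≫ gammaAct B γ (B ⊗ V) := by
  rw [gammaAct_comp_gammaAct, ← hs]; rfl

theorem kleisliCell_src (hs : c.src = γ ≫ γ ⊵ᵣ B) :
    (kleisliCell B c φ ψ).src = kleisliMap B γ φ ≫ kleisliMap B γ ψ := by
  rw [kleisliMap_comp, ← Category.assoc, ← cellAct_src B hs]; rfl

/-- Here and in the three analogous lemmas, `φ`, `ψ` and `χ` are gathered into the common tail `B ◁
B ◁ φ ≫ B ◁ ψ ≫ χ`, leaving one of the four 2-cells of `CellCocycle`. -/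
theorem kleisliCell_wr_kleisliMap :
    (kleisliCell B c φ ψ).wr (kleisliMap B γ χ) =
      ((cellAct B c V).wr (gammaAct B γ (B ⊗ B ⊗ V))).wr
        (A ⊴ᵣ (B ◁ B ◁ φ ≫ B ◁ ψ ≫ χ)) := by
  have h := actionHomRight_comp_gammaAct B γ (B ◁ φ ≫ ψ)
  rw [kleisliCell, kleisliMap, TwoCell.wr_wr, TwoCell.wr_wr, ← Category.assoc, h]
  simp only [MonoidalCategory.whiskerLeft_comp, MonoidalRightAction.actionHomRight_comp,
    Category.assoc]

theorem kleisliMap_wl_kleisliCell :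
    (kleisliCell B c ψ χ).wl (kleisliMap B γ φ) =
      ((cellAct B c (B ⊗ V)).wl (gammaAct B γ V)).wr (A ⊴ᵣ (B ◁ B ◁ φ ≫ B ◁ ψ ≫ χ)) := by
  rw [kleisliCell, kleisliMap, ← TwoCell.wl_wl, ← TwoCell.wr_wl, wl_cellAct, TwoCell.wr_wr,
    TwoCell.wr_wl, MonoidalRightAction.actionHomRight_comp A (B ◁ B ◁ φ)]

end

variable [ComonObj B]

/-- Composition of morphisms `B ⊗ V ⟶ V'` in the coKleisli category of the comonad `B ⊗ -`. -/
def coKleisliComp {V V' V'' : W} (φ : B ⊗ V ⟶ V') (ψ : B ⊗ V' ⟶ V'') : B ⊗ V ⟶ V'' :=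
  headComul B V ≫ B ◁ φ ≫ ψ

section

variable {γ} {c : TwoCell A ((A ⊙ᵣ B) ⊙ᵣ B)}

theorem cellAct_tgt (ht : c.tgt = γ ≫ comonadComul B A) (V : W) :
    (cellAct B c V).tgt = gammaAct B γ V ≫ A ⊴ᵣ headComul B V := by
  rw [gammaAct_comp_headComul, ← ht]; rfl

theorem kleisliCell_tgt (ht : c.tgt = γ ≫ comonadComul B A) :
    (kleisliCell B c φ ψ).tgt = kleisliMap B γ (coKleisliComp B φ ψ) := by
  rw [kleisliMap, coKleisliComp, MonoidalRightAction.actionHomRight_comp, ← Category.assoc,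
    ← cellAct_tgt B ht]; rfl

theorem kleisliCell_coKleisliComp_left :
    kleisliCell B c (coKleisliComp B φ ψ) χ =
      ((cellAct B c V).wr (A ⊴ᵣ (B ◁ headComul B V))).wr
        (A ⊴ᵣ (B ◁ B ◁ φ ≫ B ◁ ψ ≫ χ)) := by
  rw [kleisliCell, TwoCell.wr_wr, ← MonoidalRightAction.actionHomRight_comp, coKleisliComp]
  simp only [MonoidalCategory.whiskerLeft_comp, Category.assoc]

theorem kleisliCell_coKleisliComp_right :
    kleisliCell B c φ (coKleisliComp B ψ χ) =
      ((cellAct B c V).wr (A ⊴ᵣ headComul B (B ⊗ V))).wr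
        (A ⊴ᵣ (B ◁ B ◁ φ ≫ B ◁ ψ ≫ χ)) := by
  have h := headComul_naturality B φ
  rw [kleisliCell, TwoCell.wr_wr, ← MonoidalRightAction.actionHomRight_comp, coKleisliComp,
    reassoc_of% h]

/-- The cocycle condition on the 2-cells `c ⋆ V`. -/
def CellCocycle (γ : A ⟶ A ⊙ᵣ B) (c : TwoCell A ((A ⊙ᵣ B) ⊙ᵣ B)) (V : W) : Prop :=
  ∃ h h', ((cellAct B c V).wr (gammaAct B γ (B ⊗ B ⊗ V))).vcomp
      ((cellAct B c V).wr (A ⊴ᵣ (B ◁ headComul B V))) h =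
    ((cellAct B c (B ⊗ V)).wl (gammaAct B γ V)).vcomp
      ((cellAct B c V).wr (A ⊴ᵣ headComul B (B ⊗ V))) h'

theorem kleisliCell_assoc (hc : CellCocycle B γ c V) (h h') :
    ((kleisliCell B c φ ψ).wr (kleisliMap B γ χ)).vcomp
        (kleisliCell B c (coKleisliComp B φ ψ) χ) h =
      ((kleisliCell B c ψ χ).wl (kleisliMap B γ φ)).vcomp
        (kleisliCell B c φ (coKleisliComp B ψ χ)) h' := by
  obtain ⟨k, k', e⟩ := hc
  have e' := congrArg (TwoCell.wr · (A ⊴ᵣ (B ◁ B ◁ φ ≫ B ◁ ψ ≫ χ))) e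
  simp only [TwoCell.vcomp_wr] at e'
  refine (TwoCell.vcomp_congr ?_ ?_ _ _).trans (e'.trans (TwoCell.vcomp_congr ?_ ?_ _ _))
  · exact kleisliCell_wr_kleisliMap B φ ψ χ
  · exact kleisliCell_coKleisliComp_left B φ ψ χ
  · exact (kleisliMap_wl_kleisliCell B φ ψ χ).symm
  · exact (kleisliCell_coKleisliComp_right B φ ψ χ).symm

/-- The composites `φψ` and `ψχ` are free variables so that `hatMap` of a composite, only
propositionally a coKleisli composite, can be substituted. -/
theorem kleisliCell_cast_assoc (hc : CellCocycle B γ c V)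
    {φψ : B ⊗ V ⟶ V''} {ψχ : B ⊗ V' ⟶ V'''} (hφψ : φψ = coKleisliComp B φ ψ)
    (hψχ : ψχ = coKleisliComp B ψ χ) {ω ω' : A ⊙ᵣ V ⟶ A ⊙ᵣ V'''}
    (h₁ : (kleisliCell B c φ ψ).src = kleisliMap B γ φ ≫ kleisliMap B γ ψ)
    (h₂ : (kleisliCell B c φ ψ).tgt = kleisliMap B γ φψ)
    (h₃ : (kleisliCell B c φψ χ).src = kleisliMap B γ φψ ≫ kleisliMap B γ χ)
    (h₄ : (kleisliCell B c φψ χ).tgt = ω)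
    (h₅ : (kleisliCell B c ψ χ).src = kleisliMap B γ ψ ≫ kleisliMap B γ χ)
    (h₆ : (kleisliCell B c ψ χ).tgt = kleisliMap B γ ψχ)
    (h₇ : (kleisliCell B c φ ψχ).src = kleisliMap B γ φ ≫ kleisliMap B γ ψχ)
    (h₈ : (kleisliCell B c φ ψχ).tgt = ω') :
    EqTwoCell
      ((kleisliCell B c φ ψ).cast h₁ h₂ ▷ kleisliMap B γ χ ≫ (kleisliCell B c φψ χ).cast h₃ h₄)
      (kleisliMap B γ φ ◁ (kleisliCell B c ψ χ).cast h₅ h₆ ≫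
        (kleisliCell B c φ ψχ).cast h₇ h₈) := by
  subst hφψ hψχ
  rw [TwoCell.eqTwoCell_iff, TwoCell.of_whiskerRight_comp, TwoCell.of_whiskerLeft_comp]
  refine (TwoCell.vcomp_congr ?_ (TwoCell.of_cast _ _ _) _ ?_).trans
    ((kleisliCell_assoc B φ ψ χ hc ?_ ?_).trans
      (TwoCell.vcomp_congr ?_ (TwoCell.of_cast _ _ _).symm ?_ _))
  · rw [TwoCell.of_cast]
  · rw [TwoCell.wr_tgt, h₂, h₃]
  · rw [TwoCell.wr_tgt, h₂, h₃]
  · rw [TwoCell.wl_tgt, h₆, h₇]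
  · rw [TwoCell.of_cast]
  · rw [TwoCell.wl_tgt, h₆, h₇]

/-- By naturality the counit slides to the head of `B ⊗ B ⊗ V`, where `hc` trivialises the cell. -/
theorem kleisliCell_headCounit_right
    (hc : (cellAct B c V).wr (A ⊴ᵣ headCounit B (B ⊗ V)) = TwoCell.idCell (gammaAct B γ V))
    (θ : V' ⟶ V'') :
    kleisliCell B c φ (headCounit B V' ≫ θ) =
      TwoCell.idCell (kleisliMap B γ (φ ≫ θ)) := by
  have h := headCounit_naturality B φ
  rw [kleisliCell, reassoc_of% h, MonoidalRightAction.actionHomRight_comp, ← TwoCell.wr_wr, hc,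
    TwoCell.idCell_wr, kleisliMap]

theorem kleisliCell_headCounit_left
    (hc : (cellAct B c V).wr (A ⊴ᵣ (B ◁ headCounit B V)) = TwoCell.idCell (gammaAct B γ V))
    (θ : V ⟶ V') :
    kleisliCell B c (headCounit B V ≫ θ) ψ =
      TwoCell.idCell (kleisliMap B γ (B ◁ θ ≫ ψ)) := by
  rw [kleisliCell, MonoidalCategory.whiskerLeft_comp, Category.assoc,
    MonoidalRightAction.actionHomRight_comp, ← TwoCell.wr_wr, hc, TwoCell.idCell_wr, kleisliMap]

theorem kleisliMap_headCounit_comp (hγ : γ ≫ comonadCounit B A = 𝟙 A) (θ : V ⟶ V') :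
    kleisliMap B γ (headCounit B V ≫ θ) = A ⊴ᵣ θ := by
  rw [kleisliMap, MonoidalRightAction.actionHomRight_comp, ← Category.assoc,
    gammaAct_comp_headCounit, hγ]
  simp

end

end Kleisli

/-! ### From `DeltaTop` to the coKleisli category of `B ⊗ -`. -/

section HatMap

variable {W : Type u₁} [Category.{v₁} W] [MonoidalCategory W] (B : W) [ComonObj B]

namespace DeltaTop

variable {m n p : DeltaTop}

/-- The morphism `B ⊗ B^{⊗ m} ⟶ B^{⊗ n}` of tensor powers induced by `hat f`. -/
noncomputable def hatMap (f : m ⟶ n) : B ⊗ tensorPow B m.len ⟶ tensorPow B n.len :=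
  powMap B (hat f) (preservesBot_hat f)

theorem powMap_congr {f g : m ⟶ n} (h : f = g) (hf : PreservesBot f) (hg : PreservesBot g) :
    powMap B f hf = powMap B g hg := by
  subst h; rfl

theorem hatMap_of_preservesBot (f : m ⟶ n) (hf : PreservesBot f) :
    hatMap B f = headCounit B (tensorPow B m.len) ≫ powMap B f hf := by
  refine (powMap_congr B (hat_eq_of_preservesBot hf) _
    ((preservesBot_s _ _).comp hf)).trans ?_
  refine (powMap_comp B _ _ (preservesBot_s _ _) hf _).trans ?_
  rw [powMap_s, powCounit_zero]
  rfl

theorem hatMap_id (m : DeltaTop) : hatMap B (𝟙 m) = headCounit B (tensorPow B m.len) := by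
  rw [hatMap_of_preservesBot B _ (preservesBot_id m), powMap_id]
  exact Category.comp_id _

theorem hatMap_comp (f : m ⟶ n) (g : n ⟶ p) :
    hatMap B (f ≫ g) = coKleisliComp B (hatMap B f) (hatMap B g) := by
  have h₁ : PreservesBot (cons (hat f) ≫ hat g) :=
    (preservesBot_cons _).comp (preservesBot_hat _)
  refine (powMap_congr B (hat_comp f g) _ ((preservesBot_dSucc _ _).comp h₁)).trans ?_
  refine (powMap_comp B _ _ (preservesBot_dSucc _ _) h₁ _).trans ?_
  rw [powMap_dSucc, powComul_zero]
  refine congrArg (headComul B (tensorPow B m.len) ≫ ·) ?_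
  refine (powMap_comp B _ _ (preservesBot_cons _) (preservesBot_hat _) _).trans ?_
  rw [powMap_cons B (hat f) (preservesBot_hat f)]
  rfl

theorem hatMap_dZero (n : ℕ) : hatMap B (dZero n) = 𝟙 (B ⊗ tensorPow B n) := by
  have h : hat (dZero n) = 𝟙 (⟨n + 1⟩ : DeltaTop) := hom_ext_succ rfl fun _ => rfl
  exact (powMap_congr B h _ (preservesBot_id _)).trans (powMap_id B _)

theorem hatMap_dZero_comp_dZero (n : ℕ) :
    hatMap B (dZero n ≫ dZero (n + 1)) = headComul B (tensorPow B n) := by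
  rw [hatMap_comp, hatMap_dZero]
  refine (congrArg (coKleisliComp B _) (hatMap_dZero B (n + 1))).trans ?_
  exact (congrArg (_ ≫ ·) ((congrArg (· ≫ _) (MonoidalCategory.whiskerLeft_id _ _)).trans
    (Category.comp_id _))).trans (Category.comp_id _)

theorem hatMap_oplusMap (f : m ⟶ n) (k : ℕ) :
    ((α_ B (tensorPow B m.len) (tensorPow B k)).hom ≫ B ◁ (tensorPowAdd B m.len k).hom) ≫
        hatMap B (oplusMap f k) =
      hatMap B f ▷ tensorPow B k ≫ (tensorPowAdd B n.len k).hom := by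
  have h := tensorPowAdd_comp_powMap_oplusMap B (hat f) (preservesBot_hat f) k
    ((oplusMap_hat f k).symm ▸ preservesBot_hat _)
  exact (congrArg (_ ≫ ·) (powMap_congr B (oplusMap_hat f k).symm _ _)).trans h

end DeltaTop

end HatMap

/-! ### From coalgebra structures to lax functor structures. -/

section Forward

variable {W : Type u₁} [Category.{v₁} W] [MonoidalCategory W]
  {𝒜 : Type u} [Bicategory.{w, v} 𝒜] [Bicategory.Strict 𝒜] [TwoAction W 𝒜]
  {B : W} [ComonObj B] {A : 𝒜} {γ : A ⟶ A ⊙ᵣ B}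

open DeltaTop

/-- The conditions of a normal lax coalgebra, for bundled 2-cells. -/
structure IsCoalgebraCell (γ : A ⟶ A ⊙ᵣ B) (c : TwoCell A ((A ⊙ᵣ B) ⊙ᵣ B)) : Prop where
  src_eq : c.src = γ ≫ γ ⊵ᵣ B
  tgt_eq : c.tgt = γ ≫ comonadComul B A
  counit : γ ≫ comonadCounit B A = 𝟙 A
  cocycle : ∃ h h', ((c.act B).wl γ).vcomp (c.wr (comonadComul B A ⊵ᵣ B)) h =
    (c.wr ((γ ⊵ᵣ B) ⊵ᵣ B)).vcomp (c.wr (comonadComul B (A ⊙ᵣ B))) h'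
  normal_left : c.wr (comonadCounit B (A ⊙ᵣ B)) = TwoCell.idCell γ
  normal_right : c.wr (comonadCounit B A ⊵ᵣ B) = TwoCell.idCell γ

/-- The conditions of a normal lax coalgebra, acted on by `V`. -/
structure IsActedCoalgebraCell (γ : A ⟶ A ⊙ᵣ B) (c : TwoCell A ((A ⊙ᵣ B) ⊙ᵣ B)) (V : W) :
    Prop where
  cocycle : CellCocycle B γ c V
  headCounit : (cellAct B c V).wr (A ⊴ᵣ headCounit B (B ⊗ V)) = TwoCell.idCell (gammaAct B γ V)
  whiskerLeft_headCounit :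
    (cellAct B c V).wr (A ⊴ᵣ (B ◁ _root_.headCounit B V)) = TwoCell.idCell (gammaAct B γ V)

theorem NormalLaxCoalgebra.isCoalgebraCell (t : NormalLaxCoalgebra B γ) :
    IsCoalgebraCell γ (TwoCell.of t.τ) where
  src_eq := rfl
  tgt_eq := rfl
  counit := t.counit
  cocycle := ⟨_, _, TwoCell.eqTwoCell_iff.1 t.cocycle⟩
  normal_left := TwoCell.eqTwoCell_iff.1 t.normal_left
  normal_right := TwoCell.eqTwoCell_iff.1 t.normal_right

/-- The normal lax coalgebra with a given bundled 2-cell. -/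
def IsCoalgebraCell.toNormalLaxCoalgebra {c : TwoCell A ((A ⊙ᵣ B) ⊙ᵣ B)}
    (h : IsCoalgebraCell γ c) : NormalLaxCoalgebra B γ where
  τ := c.cast h.src_eq h.tgt_eq
  counit := h.counit
  cocycle := by
    obtain ⟨k, k', e⟩ := h.cocycle
    have e₀ : TwoCell.of (c.cast h.src_eq h.tgt_eq) = c := TwoCell.of_cast _ _ _
    rw [TwoCell.eqTwoCell_iff, TwoCell.of_comp_eqToHom_comp, TwoCell.of_comp_eqToHom_comp]
    refine (TwoCell.vcomp_congr ?_ ?_ _ _).trans (e.trans (TwoCell.vcomp_congr ?_ ?_ _ _))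
    · exact congrArg (fun d : TwoCell _ _ => (d.act B).wl γ) e₀
    · exact congrArg (fun d : TwoCell _ _ => d.wr _) e₀
    · exact congrArg (fun d : TwoCell _ _ => d.wr _) e₀.symm
    · exact congrArg (fun d : TwoCell _ _ => d.wr _) e₀.symm
  normal_left := TwoCell.eqTwoCell_iff.2 (by
    rw [← TwoCell.of_wr, TwoCell.of_cast, h.normal_left])
  normal_right := TwoCell.eqTwoCell_iff.2 (by
    rw [← TwoCell.of_wr, TwoCell.of_cast, h.normal_right])

theorem IsCoalgebraCell.acted {c : TwoCell A ((A ⊙ᵣ B) ⊙ᵣ B)} (hc : IsCoalgebraCell γ c) (V : W) :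
    IsActedCoalgebraCell γ c V where
  cocycle := by
    obtain ⟨k, k', e⟩ := hc.cocycle
    have e' := congrArg (fun d => TwoCell.wr (TwoCell.act d V)
      ((assocTwo B (A ⊙ᵣ B) V).hom ≫ (αᵣ A B (B ⊗ B ⊗ V)).inv)) e.symm
    rw [TwoCell.act_vcomp_wr, TwoCell.act_vcomp_wr] at e'
    have h₁ := cellAct_wr_gammaAct B γ c V
    have h₂ := cellAct_wr_whiskerLeft_headComul B c V
    have h₃ := gammaAct_wl_cellAct B γ c V
    have h₄ := cellAct_wr_headComul B c V
    refine ⟨?_, ?_, (TwoCell.vcomp_congr h₁ h₂ _ _).trans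
      (e'.trans (TwoCell.vcomp_congr h₃ h₄ _ _).symm)⟩
    · rw [h₁, h₂]
      exact congrArg (fun f => f ⊵ᵣ V ≫ _) k'
    · rw [h₃, h₄]
      exact congrArg (fun f => f ⊵ᵣ V ≫ _) k
  headCounit := by
    rw [cellAct_wr_headCounit, hc.normal_right, TwoCell.act_idCell, TwoCell.idCell_wr]
    rfl
  whiskerLeft_headCounit := by
    rw [cellAct_wr_whiskerLeft_headCounit, hc.normal_left, TwoCell.act_idCell, TwoCell.idCell_wr]
    rfl

/-- Converse of `IsCoalgebraCell.acted` at the unit object: the invertible 1-cells are cancelled,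
and then `- ⋆ I` by its faithfulness. -/
theorem IsActedCoalgebraCell.of_unit {c : TwoCell A ((A ⊙ᵣ B) ⊙ᵣ B)}
    (hs : c.src = γ ≫ γ ⊵ᵣ B) (ht : c.tgt = γ ≫ comonadComul B A)
    (hγ : gammaAct B γ (𝟙_ W) ≫ A ⊴ᵣ _root_.headCounit B (𝟙_ W) = 𝟙 _)
    (hc : IsActedCoalgebraCell γ c (𝟙_ W)) : IsCoalgebraCell γ c where
  src_eq := hs
  tgt_eq := ht
  counit := by
    rw [gammaAct_comp_headCounit, MonoidalRightAction.unit_actionHomRight, Iso.hom_comp_eq_id,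
      Iso.comp_inv_eq, Iso.inv_hom_id] at hγ
    exact hγ
  cocycle := by
    obtain ⟨k, k', e⟩ := hc.cocycle
    have h₁ := cellAct_wr_gammaAct B γ c (𝟙_ W)
    have h₂ := cellAct_wr_whiskerLeft_headComul B c (𝟙_ W)
    have h₃ := gammaAct_wl_cellAct B γ c (𝟙_ W)
    have h₄ := cellAct_wr_headComul B c (𝟙_ W)
    refine ⟨?_, ?_, ?_⟩
    · simp [hs, ht]
    · simp [hs, ht, comonadComul_naturality]
    · apply TwoCell.act_unit_cancel (W := W)
      apply TwoCell.wr_cancel ((assocTwo B (A ⊙ᵣ B) (𝟙_ W)) ≪≫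
        (αᵣ A B (B ⊗ B ⊗ 𝟙_ W)).symm).hom_inv_id
      rw [TwoCell.act_vcomp_wr, TwoCell.act_vcomp_wr]
      exact (TwoCell.vcomp_congr h₃.symm h₄.symm _ _).trans
        (e.symm.trans (TwoCell.vcomp_congr h₁ h₂ _ _))
  normal_left := by
    have h := hc.whiskerLeft_headCounit
    rw [cellAct_wr_whiskerLeft_headCounit] at h
    apply TwoCell.act_unit_cancel (W := W)
    apply TwoCell.wr_cancel (αᵣ A B (𝟙_ W)).inv_hom_id
    rw [h, TwoCell.act_idCell, TwoCell.idCell_wr]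
    rfl
  normal_right := by
    have h := hc.headCounit
    rw [cellAct_wr_headCounit] at h
    apply TwoCell.act_unit_cancel (W := W)
    apply TwoCell.wr_cancel (αᵣ A B (𝟙_ W)).inv_hom_id
    rw [h, TwoCell.act_idCell, TwoCell.idCell_wr]
    rfl

theorem IsCoalgebraCell.kleisliMap_hatMap_of_preservesBot {c : TwoCell A ((A ⊙ᵣ B) ⊙ᵣ B)}
    (hc : IsCoalgebraCell γ c) {m n : DeltaTop} (f : m ⟶ n) (hf : PreservesBot f) :
    kleisliMap B γ (hatMap B f) = A ⊴ᵣ powMap B f hf := by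
  rw [hatMap_of_preservesBot B f hf, kleisliMap_headCounit_comp B hc.counit]

theorem IsCoalgebraCell.kleisliCell_hatMap_left {c : TwoCell A ((A ⊙ᵣ B) ⊙ᵣ B)}
    (hc : IsCoalgebraCell γ c) {m n p : DeltaTop} (f : m ⟶ n) (g : n ⟶ p) (hf : PreservesBot f) :
    kleisliCell B c (hatMap B f) (hatMap B g) =
      TwoCell.idCell (kleisliMap B γ (B ◁ powMap B f hf ≫ hatMap B g)) := by
  rw [hatMap_of_preservesBot B f hf]
  exact kleisliCell_headCounit_left B _ (hc.acted _).whiskerLeft_headCounit _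

theorem IsCoalgebraCell.kleisliCell_hatMap_right {c : TwoCell A ((A ⊙ᵣ B) ⊙ᵣ B)}
    (hc : IsCoalgebraCell γ c) {m n p : DeltaTop} (f : m ⟶ n) (g : n ⟶ p) (hg : PreservesBot g) :
    kleisliCell B c (hatMap B f) (hatMap B g) =
      TwoCell.idCell (kleisliMap B γ (hatMap B f ≫ powMap B g hg)) := by
  rw [hatMap_of_preservesBot B g hg]
  exact kleisliCell_headCounit_right B _ (hc.acted _).headCounit _

/-- The normal lax functor structure given by a normal lax coalgebra structure. -/
noncomputable def IsCoalgebraCell.toNormalLaxAbar {c : TwoCell A ((A ⊙ᵣ B) ⊙ᵣ B)}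
    (hc : IsCoalgebraCell γ c) : NormalLaxAbar B γ where
  map f := kleisliMap B γ (hatMap B f)
  map_id m := by
    rw [hc.kleisliMap_hatMap_of_preservesBot _ (preservesBot_id m), powMap_id,
      MonoidalRightAction.actionHomRight_id]
    rfl
  mapComp f g := (kleisliCell B c (hatMap B f) (hatMap B g)).cast
    (kleisliCell_src B _ _ hc.src_eq)
    ((kleisliCell_tgt B _ _ hc.tgt_eq).trans (by rw [hatMap_comp]))
  mapComp_id_left {m n} f :=
    TwoCell.isIdTwoCell_cast (hc.kleisliCell_hatMap_left _ f (preservesBot_id m)) _ _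
  mapComp_id_right {m n} f :=
    TwoCell.isIdTwoCell_cast (hc.kleisliCell_hatMap_right f _ (preservesBot_id n)) _ _
  mapComp_assoc {m n p q} f g h :=
    kleisliCell_cast_assoc B (hatMap B f) (hatMap B g) (hatMap B h)
      (hc.acted _).cocycle (hatMap_comp B f g) (hatMap_comp B g h) _ _ _ _ _ _ _ _
  map_dZero n := (congrArg (kleisliMap B γ) (hatMap_dZero B n)).trans (kleisliMap_id B γ _)
  map_dSucc n r := by
    rw [hc.kleisliMap_hatMap_of_preservesBot _ (preservesBot_dSucc n r), powMap_dSucc]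
  map_s n r := by
    rw [hc.kleisliMap_hatMap_of_preservesBot _ (preservesBot_s n r), powMap_s]
  mapComp_isId f g h := by
    obtain h | h := h
    · exact TwoCell.isIdTwoCell_cast (hc.kleisliCell_hatMap_left f g h) _ _
    · exact TwoCell.isIdTwoCell_cast (hc.kleisliCell_hatMap_right f g h) _ _
  map_oplus f k := kleisliMap_act B γ _ _ _ _ (hatMap_oplusMap B f k)
  mapComp_oplus f g k := TwoCell.eqTwoCell_cast_act
    (kleisliCell_act B _ _ c _ _ _ _ _ (hatMap_oplusMap B f k) (hatMap_oplusMap B g k)) _ _ _ _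

end Forward

/-! ### From lax functor structures back to coalgebra structures, and the bijection. -/

section Backward

variable {W : Type u₁} [Category.{v₁} W] [MonoidalCategory W]
  {𝒜 : Type u} [Bicategory.{w, v} 𝒜] [Bicategory.Strict 𝒜] [TwoAction W 𝒜]
  {B : W} [ComonObj B] {A : 𝒜} {γ : A ⟶ A ⊙ᵣ B}

open DeltaTop

namespace NormalLaxAbar

theorem ext_of_map_of_mapComp {F G : NormalLaxAbar B γ}
    (h : ∀ {m n : DeltaTop} (f : m ⟶ n), F.map f = G.map f)
    (h' : ∀ {m n p : DeltaTop} (f : m ⟶ n) (g : n ⟶ p),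
      TwoCell.of (F.mapComp f g) = TwoCell.of (G.mapComp f g)) : F = G := by
  obtain ⟨⟨map, _, mapComp, _, _, _⟩, _, _, _, _, _, _⟩ := F
  obtain ⟨⟨map', _, mapComp', _, _, _⟩, _, _, _, _, _, _⟩ := G
  obtain rfl : @map = @map' := by
    funext m n f
    exact h f
  obtain rfl : @mapComp = @mapComp' := by
    funext m n p f g
    exact TwoCell.of_injective (h' f g)
  rfl

variable (F : NormalLaxAbar B γ) {m n p q : DeltaTop}

/-- The composition constraint as a bundled 2-cell. -/
def constraint (f : m ⟶ n) (g : n ⟶ p) : TwoCell (abarObj B A m) (abarObj B A p) :=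
  TwoCell.of (F.mapComp f g)

theorem map_comp (f : m ⟶ n) (g : n ⟶ p) (h : PreservesBot f ∨ PreservesBot g) :
    F.map (f ≫ g) = F.map f ≫ F.map g :=
  (F.mapComp_isId f g h).choose.symm

theorem constraint_of_preservesBot (f : m ⟶ n) (g : n ⟶ p)
    (h : PreservesBot f ∨ PreservesBot g) :
    F.constraint f g = TwoCell.idCell (F.map f ≫ F.map g) :=
  TwoCell.isIdTwoCell_iff.1 (F.mapComp_isId f g h)

theorem constraint_assoc (f : m ⟶ n) (g : n ⟶ p) (h : p ⟶ q) :
    ((F.constraint f g).wr (F.map h)).vcomp (F.constraint (f ≫ g) h) rfl =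
      ((F.constraint g h).wl (F.map f)).vcomp (F.constraint f (g ≫ h)) rfl := by
  have e := TwoCell.eqTwoCell_iff.1 (F.mapComp_assoc f g h)
  rw [TwoCell.of_whiskerRight_comp, TwoCell.of_whiskerLeft_comp] at e
  exact e

/-- In the associativity law for `(f, g, h)` both constraints whose second factor is `h` are
identities. In the next lemma, the constraints at `(f, g)` and `(g, h)` are. -/
theorem constraint_comp_right (f : m ⟶ n) (g : n ⟶ p) (h : p ⟶ q) (hh : PreservesBot h) :
    F.constraint f (g ≫ h) = (F.constraint f g).wr (F.map h) := by
  have e := F.constraint_assoc f g h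
  have h₁ := F.constraint_of_preservesBot (f ≫ g) h (.inr hh)
  have h₂ := F.constraint_of_preservesBot g h (.inr hh)
  have e₁ := (TwoCell.vcomp_congr rfl h₁.symm rfl rfl).trans e
  have e₂ := e₁.trans (TwoCell.vcomp_congr ((congrArg (TwoCell.wl (F.map f)) h₂).trans
    (TwoCell.wl_idCell _ _)) rfl rfl (by
      change F.map f ≫ F.map g ≫ F.map h = F.map f ≫ F.map (g ≫ h)
      rw [F.map_comp g h (.inr hh)]))
  exact ((TwoCell.vcomp_idCell _ _ _).symm.trans (e₂.trans (TwoCell.idCell_vcomp _ _ _))).symm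

theorem constraint_comp_mid (f : m ⟶ n) (g : n ⟶ p) (h : p ⟶ q) (hg : PreservesBot g) :
    F.constraint (f ≫ g) h = F.constraint f (g ≫ h) := by
  have e := F.constraint_assoc f g h
  have h₁ := F.constraint_of_preservesBot f g (.inr hg)
  have h₂ := F.constraint_of_preservesBot g h (.inl hg)
  have e₁ := (TwoCell.vcomp_congr ((congrArg (TwoCell.wr · (F.map h)) h₁).trans
    (TwoCell.idCell_wr _ _)).symm rfl (by
      change (F.map f ≫ F.map g) ≫ F.map h = F.map (f ≫ g) ≫ F.map h
      rw [F.map_comp f g (.inr hg)]) rfl).trans e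
  have e₂ := e₁.trans (TwoCell.vcomp_congr ((congrArg (TwoCell.wl (F.map f)) h₂).trans
    (TwoCell.wl_idCell _ _)) rfl rfl (by
      change F.map f ≫ F.map g ≫ F.map h = F.map f ≫ F.map (g ≫ h)
      rw [F.map_comp g h (.inl hg)]))
  exact (TwoCell.idCell_vcomp _ _ _).symm.trans (e₂.trans (TwoCell.idCell_vcomp _ _ _))

theorem map_of_preservesBot (f : m ⟶ n) (hf : PreservesBot f) :
    F.map f = A ⊴ᵣ powMap B f hf := by
  have hg := isGenerated_of_preservesBot f hf
  induction hg with
  | id =>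
    rw [F.map_id, powMap_id, MonoidalRightAction.actionHomRight_id]
    rfl
  | comp_dSucc g r hg ih =>
    rw [F.map_comp _ _ (.inr (preservesBot_dSucc _ _)), ih hg.preservesBot, F.map_dSucc,
      powMap_comp B _ _ hg.preservesBot (preservesBot_dSucc _ _), powMap_dSucc]
    exact (MonoidalRightAction.actionHomRight_comp _ _ _).symm
  | comp_s g r hg ih =>
    rw [F.map_comp _ _ (.inr (preservesBot_s _ _)), ih hg.preservesBot, F.map_s,
      powMap_comp B _ _ hg.preservesBot (preservesBot_s _ _), powMap_s]
    exact (MonoidalRightAction.actionHomRight_comp _ _ _).symm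

theorem map_hat (f : m ⟶ n) : F.map (hat f) = A ⊴ᵣ hatMap B f :=
  F.map_of_preservesBot _ (preservesBot_hat f)

theorem map_eq (f : m ⟶ n) : F.map f = kleisliMap B γ (hatMap B f) :=
  -- The composite `dZero m.len ≫ hat f` is `f` by definitional unfolding.
  (F.map_comp (dZero m.len) (hat f) (.inr (preservesBot_hat f))).trans
    (congrArg₂ (fun a b => a ≫ b) (F.map_dZero m.len) (F.map_hat f))

/-- With `f = dZero ≫ hat f` and `g = dZero ≫ hat g`, first `hat g` is pulled out on the right and
`hat f` is moved across to the second argument. There `hat f ≫ dZero = dZero ≫ cons (hat f)`, so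
`cons (hat f)` can be pulled out as well. -/
theorem constraint_eq (f : m ⟶ n) (g : n ⟶ p) :
    F.constraint f g = (F.constraint (dZero m.len) (dZero (m.len + 1))).wr
      (A ⊴ᵣ (B ◁ hatMap B f ≫ hatMap B g)) := by
  have h₁ : F.map (DeltaTop.cons (hat f)) = A ⊴ᵣ (B ◁ hatMap B f) :=
    (F.map_of_preservesBot _ (preservesBot_cons _)).trans
      (congrArg (A ⊴ᵣ ·) (powMap_cons B _ (preservesBot_hat f) _))
  refine (F.constraint_comp_right f (dZero n.len) (hat g) (preservesBot_hat g)).trans ?_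
  refine (congrArg (TwoCell.wr · _)
    ((F.constraint_comp_mid (dZero m.len) (hat f) (dZero n.len) (preservesBot_hat f)).trans
    (F.constraint_comp_right (dZero m.len) (dZero (m.len + 1)) (DeltaTop.cons (hat f))
      (preservesBot_cons _)))).trans ?_
  refine (TwoCell.wr_wr _ _ _).trans (congrArg (TwoCell.wr _) ?_)
  exact (congrArg₂ (fun a b => a ≫ b) h₁ (F.map_hat g)).trans
    (MonoidalRightAction.actionHomRight_comp _ _ _).symm

/-- The 2-cell `(γ ⋆ B) ∘ γ ⟶ comul ∘ γ` underlying the lax coalgebra given by `F`. -/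
def tauCell : TwoCell A ((A ⊙ᵣ B) ⊙ᵣ B) :=
  TwoCell.wl (ρᵣ[W] A).inv (TwoCell.wr
    (F.constraint (dZero 0) (dZero 1) : TwoCell (A ⊙ᵣ 𝟙_ W) (A ⊙ᵣ (B ⊗ B ⊗ 𝟙_ W)))
    ((assocTwo B A (𝟙_ W)).inv ≫ (ρᵣ[W] ((A ⊙ᵣ B) ⊙ᵣ B)).hom))

theorem cellAct_tauCell_zero :
    cellAct B F.tauCell (𝟙_ W) = F.constraint (dZero 0) (dZero 1) :=
  cellAct_conj_unit B _

theorem constraint_congr {f f' : m ⟶ n} {g g' : n ⟶ p} (hf : f = f') (hg : g = g') :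
    F.constraint f g = F.constraint f' g' := by
  subst hf hg; rfl

/-- Since `dZero n` is `dZero 0 ⊕ 1`, the action axiom `mapComp_oplus` determines this constraint up
to whiskering by the invertible `abarOplus B A ⟨0⟩ n`, which is cancelled. -/
theorem constraint_dZero_dZero (n : ℕ) :
    F.constraint (dZero n) (dZero (n + 1)) = cellAct B F.tauCell (tensorPow B n) := by
  have h₁ := TwoCell.eqTwoCell_iff.1 (F.mapComp_oplus (dZero 0) (dZero 1) n)
  have h₂ : F.constraint (oplusMap (dZero 0) n) (oplusMap (dZero 1) n) =
      F.constraint (dZero n) (dZero (n + 1)) :=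
    F.constraint_congr (oplusMap_dZero 0 n) (oplusMap_dZero 1 n)
  have h₃ : TwoCell.wl (abarOplus B A ⟨0⟩ n) (F.constraint (dZero n) (dZero (n + 1))) =
      ((F.constraint (dZero 0) (dZero 1)).act (tensorPow B n)).wr (abarOplus B A ⟨2⟩ n) :=
    (congrArg (TwoCell.wl _) h₂.symm).trans h₁
  have h₄ := cellAct_act_comp B F.tauCell (tensorPowAdd B 0 n).hom
  have h₅ := congrArg (fun d => TwoCell.wr (TwoCell.act d (tensorPow B n))
    (abarOplus B A ⟨2⟩ n)) F.cellAct_tauCell_zero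
  refine TwoCell.wl_cancel (f := abarOplus B A ⟨0⟩ n)
    (f' := A ⊴ᵣ (tensorPowAdd B 0 n).inv ≫ (αᵣ A (tensorPow B 0) (tensorPow B n)).hom)
    (actionHomRight_inv_comp_assoc A _) (h₃.trans (h₅.symm.trans h₄.symm))

theorem constraint_eq_kleisliCell (f : m ⟶ n) (g : n ⟶ p) :
    F.constraint f g = kleisliCell B F.tauCell (hatMap B f) (hatMap B g) :=
  (F.constraint_eq f g).trans
    (congrArg (TwoCell.wr · _) (F.constraint_dZero_dZero m.len))

theorem tauCell_src : F.tauCell.src = γ ≫ γ ⊵ᵣ B := by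
  have h : F.map (dZero 0) ≫ F.map (dZero 1) = gammaAct B γ (𝟙_ W) ≫ gammaAct B γ (B ⊗ 𝟙_ W) :=
    congrArg₂ (fun a b => a ≫ b) (F.map_dZero 0) (F.map_dZero 1)
  change (ρᵣ[W] A).inv ≫ (F.map (dZero 0) ≫ F.map (dZero 1)) ≫ _ = _
  refine (congrArg (fun a => (ρᵣ[W] A).inv ≫ a ≫ _)
    (h.trans (gammaAct_comp_gammaAct B γ _))).trans ?_
  exact conj_act_unit B _

theorem tauCell_tgt : F.tauCell.tgt = γ ≫ comonadComul B A := by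
  have h : F.map (dZero 0 ≫ dZero 1) = gammaAct B γ (𝟙_ W) ≫ A ⊴ᵣ headComul B (𝟙_ W) :=
    (F.map_eq _).trans (congrArg (kleisliMap B γ) (hatMap_dZero_comp_dZero B 0))
  change (ρᵣ[W] A).inv ≫ F.map (dZero 0 ≫ dZero 1) ≫ _ = _
  refine (congrArg (fun a => (ρᵣ[W] A).inv ≫ a ≫ _)
    (h.trans (gammaAct_comp_headComul B γ _))).trans ?_
  exact conj_act_unit B _

/-- The cocycle is lax associativity at three successive `dZero`s. The two normality conditions are
the identity constraints at `(dZero 0, 𝟙)` and `(𝟙, dZero 0)`, because `hatMap` of an identity is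
the counit. -/
theorem isActedCoalgebraCell_tauCell : IsActedCoalgebraCell γ F.tauCell (𝟙_ W) where
  cocycle := by
    refine TwoCell.exists_vcomp_eq_vcomp ?_ ?_ ?_ ?_
      (F.constraint_assoc (dZero 0) (dZero 1) (dZero 2))
    · exact congrArg₂ TwoCell.wr (F.constraint_dZero_dZero 0) (F.map_dZero 2)
    · refine (F.constraint_eq_kleisliCell _ _).trans ?_
      refine (congrArg₂ (kleisliCell B F.tauCell) (hatMap_dZero_comp_dZero B 0)
        (hatMap_dZero B 2)).trans ?_
      exact kleisliCell_id_right B _ _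
    · exact congrArg₂ TwoCell.wl (F.map_dZero 0) (F.constraint_dZero_dZero 1)
    · refine (F.constraint_eq_kleisliCell _ _).trans ?_
      refine (congrArg₂ (kleisliCell B F.tauCell) (hatMap_dZero B 0)
        (hatMap_dZero_comp_dZero B 1)).trans ?_
      exact kleisliCell_id_left B _ _
  headCounit := by
    refine (kleisliCell_id_left B _ _).symm.trans ?_
    refine (congrArg₂ (kleisliCell B F.tauCell) (hatMap_dZero B 0) (hatMap_id B ⟨1⟩)).symm.trans ?_
    refine (F.constraint_eq_kleisliCell _ _).symm.trans ?_
    refine (F.constraint_of_preservesBot _ _ (.inr (preservesBot_id _))).trans ?_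
    refine congrArg TwoCell.idCell ((F.map_comp _ _ (.inr (preservesBot_id _))).symm.trans ?_)
    exact (congrArg F.map (Category.comp_id _)).trans (F.map_dZero 0)
  whiskerLeft_headCounit := by
    refine (kleisliCell_id_right B _ _).symm.trans ?_
    refine (congrArg₂ (kleisliCell B F.tauCell) (hatMap_id B ⟨0⟩) (hatMap_dZero B 0)).symm.trans ?_
    refine (F.constraint_eq_kleisliCell _ _).symm.trans ?_
    refine (F.constraint_of_preservesBot _ _ (.inl (preservesBot_id _))).trans ?_
    refine congrArg TwoCell.idCell ((F.map_comp _ _ (.inl (preservesBot_id _))).symm.trans ?_)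
    exact (congrArg F.map (Category.id_comp _)).trans (F.map_dZero 0)

theorem isCoalgebraCell_tauCell : IsCoalgebraCell γ F.tauCell :=
  F.isActedCoalgebraCell_tauCell.of_unit F.tauCell_src F.tauCell_tgt
    -- The counit law for `γ` comes from preservation of the identity of `⟨0⟩`.
    ((congrArg (kleisliMap B γ) (hatMap_id B ⟨0⟩)).symm.trans
      ((F.map_eq (𝟙 _)).symm.trans (F.map_id _)))

/-- The strict functor obtained by restriction to `DeltaBotTop`. -/
def restrict : DeltaBotTop ⥤ 𝒜 where
  obj n := abarObj B A (DeltaBotTop.incl.obj n)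
  map f := F.map (DeltaBotTop.incl.map f)
  map_id _ := F.map_id _
  map_comp f _ := F.map_comp _ _ (.inl f.2)

end NormalLaxAbar

/-- The normal lax functor structure on `Ā` given by a normal lax coalgebra. -/
noncomputable def NormalLaxCoalgebra.toNormalLaxAbar (t : NormalLaxCoalgebra B γ) :
    NormalLaxAbar B γ :=
  t.isCoalgebraCell.toNormalLaxAbar

theorem NormalLaxCoalgebra.constraint_toNormalLaxAbar (t : NormalLaxCoalgebra B γ)
    {m n p : DeltaTop} (f : m ⟶ n) (g : n ⟶ p) :
    t.toNormalLaxAbar.constraint f g =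
      kleisliCell B (TwoCell.of t.τ) (hatMap B f) (hatMap B g) :=
  TwoCell.of_cast (kleisliCell B (TwoCell.of t.τ) (hatMap B f) (hatMap B g))
    (kleisliCell_src B _ _ rfl)
    ((kleisliCell_tgt B _ _ rfl).trans (congrArg (kleisliMap B γ) (hatMap_comp B f g).symm))

theorem NormalLaxCoalgebra.constraint_toNormalLaxAbar_dZero (t : NormalLaxCoalgebra B γ) (n : ℕ) :
    t.toNormalLaxAbar.constraint (dZero n) (dZero (n + 1)) =
      cellAct B (TwoCell.of t.τ) (tensorPow B n) :=
  (t.constraint_toNormalLaxAbar _ _).trans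
    ((congrArg₂ (kleisliCell B (TwoCell.of t.τ)) (hatMap_dZero B n)
      (hatMap_dZero B (n + 1))).trans (kleisliCell_id_id B _ _))

/-- Injectivity reads `τ` off the constraint at `(dZero 0, dZero 1)`. Surjectivity holds because
`map_eq` and `constraint_eq_kleisliCell` express all of `F` through `γ` and `tauCell`. -/
theorem NormalLaxCoalgebra.toNormalLaxAbar_bijective :
    Function.Bijective (NormalLaxCoalgebra.toNormalLaxAbar (B := B) (γ := γ)) := by
  constructor
  · intro t t' h
    have e : cellAct B (TwoCell.of t.τ) (𝟙_ W) = cellAct B (TwoCell.of t'.τ) (𝟙_ W) :=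
      (t.constraint_toNormalLaxAbar_dZero 0).symm.trans
        ((congrArg (fun F => F.constraint (dZero 0) (dZero 1)) h).trans
          (t'.constraint_toNormalLaxAbar_dZero 0))
    have e' : TwoCell.of t.τ = TwoCell.of t'.τ :=
      TwoCell.act_unit_cancel (TwoCell.wr_cancel (assocTwo B A (𝟙_ W)).hom_inv_id e)
    exact NormalLaxCoalgebra.ext (TwoCell.of_injective e')
  · intro F
    have e : TwoCell.of F.isCoalgebraCell_tauCell.toNormalLaxCoalgebra.τ = F.tauCell :=
      TwoCell.of_cast _ F.tauCell_src F.tauCell_tgt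
    refine ⟨F.isCoalgebraCell_tauCell.toNormalLaxCoalgebra,
      NormalLaxAbar.ext_of_map_of_mapComp (fun f => (F.map_eq f).symm) fun f g => ?_⟩
    refine (NormalLaxCoalgebra.constraint_toNormalLaxAbar _ f g).trans ?_
    rw [e]
    exact (F.constraint_eq_kleisliCell f g).symm

end Backward

theorem mainTheorem9 {W : Type u₁} [Category.{v₁} W] [MonoidalCategory W]
    {𝒜 : Type u} [Bicategory.{w, v} 𝒜] [Bicategory.Strict 𝒜] [TwoAction W 𝒜]
    (B : W) [ComonObj B] (A : 𝒜) (γ : A ⟶ A ⊙ᵣ B) :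
    (∃ e : NormalLaxCoalgebra B γ ≃ NormalLaxAbar B γ,
      ∀ (t : NormalLaxCoalgebra B γ) (n : ℕ),
        EqTwoCell ((e t).mapComp (DeltaTop.dZero n) (DeltaTop.dZero (n + 1)))
          (TwoAction.actionTwo t.τ (tensorPow B n) ▷
            ((αᵣ (A ⊙ᵣ B) B (tensorPow B n)).inv ≫ (αᵣ A B (tensorPow B (n + 1))).inv))) ∧
    ∀ F : NormalLaxAbar B γ,
      ∃ (G : DeltaBotTop ⥤ 𝒜) (hobj : ∀ n, G.obj n = abarObj B A (DeltaBotTop.incl.obj n)),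
        (∀ {m n : DeltaBotTop} (f : m ⟶ n), G.map f =
          eqToHom (hobj m) ≫ F.map (DeltaBotTop.incl.map f) ≫ eqToHom (hobj n).symm) ∧
        ∀ {m n p : DeltaBotTop} (f : m ⟶ n) (g : n ⟶ p),
          IsIdTwoCell (F.mapComp (DeltaBotTop.incl.map f) (DeltaBotTop.incl.map g)) := by
  refine ⟨⟨Equiv.ofBijective _ NormalLaxCoalgebra.toNormalLaxAbar_bijective, fun t n => ?_⟩,
    fun F => ⟨F.restrict, fun _ => rfl, fun f => ?_, fun f g => ?_⟩⟩
  · exact TwoCell.eqTwoCell_iff.2 (t.constraint_toNormalLaxAbar_dZero n)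
  · exact ((Category.id_comp _).trans (Category.comp_id _)).symm
  · exact F.mapComp_isId _ _ (.inl f.2)
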